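/- Let $\mathcal T_h$ be a (finite) simplicial triangulation of a polyhedral domain $\Omega\subset\mathbb R^3$, where $\Omega$ is the interior of the union of the closed tetrahedra of $\mathcal T_h$. Let $\mathcal T_h^{\rm WF}$ be its Worsey–Farin refinement: each face $F$ of $\mathcal T_h$ gets a split point $m_F$, which is the barycenter of $F$ if $F\subset\partial\Omega$, and is the intersection of $F$ with the segment joining the incenters of $T_1$ and $T_2$ if $F$ is shared by the tetrahedra $T_1\neq T_2$ of $\mathcal T_h$; each $T\in\mathcal T_h$ is split into the twelve tetrahedra spanned by the incenter of $T$, the split point $m_F$ of a face $F$ of $T$, and an edge of $F$. Let $\mathcal S_h^I$ and $\mathcal S_h^B$ be the sets of face split points lying in $\Omega$ and on $\partial\Omega$, respectively. An edge $e$ of $\mathcal T_h^{\rm WF}$ is called singular if the faces of $\mathcal T_h^{\rm WF}$ meeting at $e$ fall on exactly two planes; it is a boundary singular edge if $e\subset\partial\Omega$ and an interior singular edge otherwise. Let $\mathcal P_0(\mathcal T_h^{\rm WF})=\prod_{K\in\mathcal T_h^{\rm WF}}\mathcal P_0(K)$ be the space of piecewise constant functions. For a singular edge $e$ list the tetrahedra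 of $\mathcal T_h^{\rm WF}$ having $e$ as an edge as $K_e^{(1)},\dots,K_e^{(n_e)}$, with $n_e=4$ if $e$ is interior and $n_e=2$ if $e$ is a boundary edge, so that $K_e^{(j)}$ and $K_e^{(j+1)}$ share a common face, and with $q_e^{(j)}=q|_{K_e^{(j)}}$ put $\theta_e(q)=q_e^{(1)}-q_e^{(2)}+q_e^{(3)}-q_e^{(4)}$ if $e$ is interior and $\theta_e(q)=q_e^{(1)}-q_e^{(2)}$ if $e$ is a boundary edge. Define $$\hat Y_h^{\rm WF}=\{q\in\mathcal P_0(\mathcal T_h^{\rm WF}) : \theta_e(q)=0 \text{ for every singular edge } e \text{ of } \mathcal T_h^{\rm WF}\}.$$ Then $\mathcal S_h^I$ and $\mathcal S_h^B$ are finite, $\hat Y_h^{\rm WF}$ is finite-dimensional, and $$\dim\hat Y_h^{\rm WF}=4|\mathcal S_h^I|+|\mathcal S_h^B|.$$ -/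

import Mathlib

namespace WorseyFarin

/-- Three-dimensional Euclidean space. -/
abbrev Point : Type := EuclideanSpace ℝ (Fin 3)

/-- The closed tetrahedra of a simplicial complex, each given by its set of four vertices. -/
def tetrahedra (𝒯 : Geometry.SimplicialComplex ℝ Point) : Set (Finset Point) :=
  {T | T ∈ 𝒯.faces ∧ T.card = 4}

/-- `𝒯` is a simplicial triangulation of the open polyhedral set `Ω ⊆ ℝ³`: a finite simplicial
complex all of whose simplices are faces of tetrahedra of the complex, and whose closed
tetrahedra cover exactly the closure of `Ω`, with `Ω` lying on both sides of no boundary face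
(equivalently, for such a complex, `Ω` is the interior of the union of the tetrahedra). -/
structure IsTriangulation (𝒯 : Geometry.SimplicialComplex ℝ Point) (Ω : Set Point) : Prop where
  finite_faces : 𝒯.faces.Finite
  pure : ∀ s ∈ 𝒯.faces, ∃ T ∈ tetrahedra 𝒯, s ⊆ T
  interior_space : interior 𝒯.space = Ω

open Classical in
/-- The incenter of the tetrahedron with vertex set `T` (zero if `T` is not the vertex set of a
nondegenerate tetrahedron). -/
noncomputable def incenter (T : Finset Point) : Point :=
  if h : ∃ S : Affine.Simplex ℝ Point 3, Set.range S.points = (T : Set Point) then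
    h.choose.incenter
  else 0

/-- The incenter does not depend on the enumeration of the vertices. -/
theorem incenter_eq_of_range_eq (S S' : Affine.Simplex ℝ Point 3)
    (h : Set.range S.points = Set.range S'.points) : S.incenter = S'.incenter := by
  have hi := S.independent.injective
  have hi' := S'.independent.injective
  let e : Fin 4 ≃ Fin 4 :=
    (Equiv.ofInjective _ hi).trans ((Equiv.setCongr h).trans (Equiv.ofInjective _ hi').symm)
  have key : S.reindex e = S' := by
    ext1 i
    obtain ⟨j, rfl⟩ := e.surjective i
    have h1 : S'.points (e j) = S.points j := by
      have := Equiv.apply_ofInjective_symm hi' (Equiv.setCongr h (Equiv.ofInjective _ hi j))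
      simpa [e] using this
    rw [h1]
    simp [Affine.Simplex.reindex]
  rw [← key, Affine.Simplex.incenter_reindex]

theorem incenter_eq (T : Finset Point) (S : Affine.Simplex ℝ Point 3)
    (h : Set.range S.points = (T : Set Point)) : incenter T = S.incenter := by
  have hex : ∃ S : Affine.Simplex ℝ Point 3, Set.range S.points = (T : Set Point) := ⟨S, h⟩
  rw [incenter, dif_pos hex]
  exact incenter_eq_of_range_eq _ _ (hex.choose_spec.trans h.symm)

/-- `m` is the split point of the triangular face `F` of the triangulation `𝒯` of `Ω`: for a face
shared by two tetrahedra, the point where the segment joining their incenters meets `F`; for a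
boundary face, its barycenter. -/
def IsSplitPoint (𝒯 : Geometry.SimplicialComplex ℝ Point) (Ω : Set Point)
    (F : Finset Point) (m : Point) : Prop :=
  F ∈ 𝒯.faces ∧ F.card = 3 ∧
    ((∃ T₁ ∈ tetrahedra 𝒯, ∃ T₂ ∈ tetrahedra 𝒯, T₁ ≠ T₂ ∧ F ⊆ T₁ ∧ F ⊆ T₂ ∧
        m ∈ segment ℝ (incenter T₁) (incenter T₂) ∧ m ∈ convexHull ℝ (F : Set Point)) ∨
      (convexHull ℝ (F : Set Point) ⊆ frontier Ω ∧ m = F.centroid ℝ id))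

/-- The interior face split points. -/
def interiorSplitPoints (𝒯 : Geometry.SimplicialComplex ℝ Point) (Ω : Set Point) : Set Point :=
  {m | (∃ F, IsSplitPoint 𝒯 Ω F m) ∧ m ∈ Ω}

/-- The boundary face split points. -/
def boundarySplitPoints (𝒯 : Geometry.SimplicialComplex ℝ Point) (Ω : Set Point) : Set Point :=
  {m | (∃ F, IsSplitPoint 𝒯 Ω F m) ∧ m ∈ frontier Ω}

/-- The tetrahedra (vertex sets) of the Worsey–Farin refinement: for each tetrahedron `T`, each
face `F` of `T` with split point `m`, and each edge `e` of `F`, the tetrahedron spanned by the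
incenter of `T`, the point `m` and the edge `e`. -/
def refinement (𝒯 : Geometry.SimplicialComplex ℝ Point) (Ω : Set Point) : Set (Finset Point) :=
  {K | ∃ T ∈ tetrahedra 𝒯, ∃ F ⊆ T, F.card = 3 ∧ ∃ m, IsSplitPoint 𝒯 Ω F m ∧
    ∃ e ⊆ F, e.card = 2 ∧ (K : Set Point) = insert (incenter T) (insert m (e : Set Point))}

/-- The simplices with `n` vertices of the triangulation with set of tetrahedra `M`. For `n = 2`
these are its edges, for `n = 3` its faces. -/
def subsimplices (M : Set (Finset Point)) (n : ℕ) : Set (Finset Point) :=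
  {s | s.card = n ∧ ∃ K ∈ M, s ⊆ K}

/-- The singular edges of the triangulation with set of tetrahedra `M`: the faces meeting at the
edge fall on exactly two planes. -/
def singularEdges (M : Set (Finset Point)) : Set (Finset Point) :=
  {e | e ∈ subsimplices M 2 ∧
    {P : AffineSubspace ℝ Point |
      ∃ f ∈ subsimplices M 3, e ⊆ f ∧ P = affineSpan ℝ (f : Set Point)}.ncard = 2}

/-- The boundary singular edges: those contained in `∂Ω`. -/
def boundarySingularEdges (M : Set (Finset Point)) (Ω : Set Point) : Set (Finset Point) :=
  {e | e ∈ singularEdges M ∧ convexHull ℝ (e : Set Point) ⊆ frontier Ω}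

/-- The interior singular edges: those not contained in `∂Ω`. -/
def interiorSingularEdges (M : Set (Finset Point)) (Ω : Set Point) : Set (Finset Point) :=
  {e | e ∈ singularEdges M ∧ ¬ convexHull ℝ (e : Set Point) ⊆ frontier Ω}

/-- `K 0, …, K (n - 1)` is a list without repetition of all tetrahedra of `M` that have `e` as an
edge, such that consecutive ones share a common face. -/
structure IsLabeling (M : Set (Finset Point)) (e : Finset Point) (n : ℕ) (K : Fin n → M) :
    Prop where
  injective : Function.Injective K
  mem_range_iff : ∀ L : M, L ∈ Set.range K ↔ e ⊆ (L : Finset Point)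
  common_face : ∀ i j : Fin n, (j : ℕ) = (i : ℕ) + 1 →
    ∃ f : Finset Point, f.card = 3 ∧ f ⊆ (K i : Finset Point) ∧ f ⊆ (K j : Finset Point)

/-- The intermediate pressure space. A piecewise constant function with respect to the refinement
is given by its constant value on each tetrahedron of the refinement. The condition `θ_e(q) = 0`
is imposed on the alternating sum over four tetrahedra at each interior singular edge, and on the
difference over two tetrahedra at each boundary singular edge. (Reversing or rotating the labels
changes `θ_e` at most by its sign, so it is harmless to require this for every labeling.) -/
def pressureSpace (𝒯 : Geometry.SimplicialComplex ℝ Point) (Ω : Set Point) :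
    Submodule ℝ (refinement 𝒯 Ω → ℝ) where
  carrier := {q |
    (∀ e ∈ interiorSingularEdges (refinement 𝒯 Ω) Ω, ∀ K : Fin 4 → refinement 𝒯 Ω,
      IsLabeling (refinement 𝒯 Ω) e 4 K → q (K 0) - q (K 1) + q (K 2) - q (K 3) = 0) ∧
    (∀ e ∈ boundarySingularEdges (refinement 𝒯 Ω) Ω, ∀ K : Fin 2 → refinement 𝒯 Ω,
      IsLabeling (refinement 𝒯 Ω) e 2 K → q (K 0) - q (K 1) = 0)}
  zero_mem' := by simp
  add_mem' := by
    rintro p q ⟨hp, hp'⟩ ⟨hq, hq'⟩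
    refine ⟨fun e he K hK => ?_, fun e he K hK => ?_⟩
    · have h1 := hp e he K hK
      have h2 := hq e he K hK
      simp only [Pi.add_apply]
      linarith
    · have h1 := hp' e he K hK
      have h2 := hq' e he K hK
      simp only [Pi.add_apply]
      linarith
  smul_mem' := by
    rintro c q ⟨hq, hq'⟩
    refine ⟨fun e he K hK => ?_, fun e he K hK => ?_⟩
    · have h2 := hq e he K hK
      simp only [Pi.smul_apply, smul_eq_mul]
      linear_combination c * h2
    · have h2 := hq' e he K hK
      simp only [Pi.smul_apply, smul_eq_mul]
      linear_combination c * h2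

end WorseyFarin

/-!
The proof shows that the conditions defining the pressure space decouple into independent local
conditions, one set for each triangular face `F` of the original triangulation, and counts.

*Split points.* Two tetrahedra with a common face lie on opposite sides of its plane
(`coord_apex_neg`), so at most two tetrahedra contain a given face. If two do, the open face lies in
`Ω`; if only one does, the face lies in `∂Ω` (`convexHull_subset_frontier`). In the first case the
inspheres touch the face at points of its relative interior, with radii orthogonal to the face and
pointing to opposite sides; hence the segment of the incenters meets the face on the segment of the
two touch points, inside the open face (`exists_mem_segment_incenter`). So every face has exactly one
split point, lying in its relative interior. Since every point lies in at most one open simplex,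
different faces have different split points, and vertices, split points and incenters never
coincide.

*Singular edges.* These are exactly the edges joining the split point of a face `F` to a vertex of
`F` (`mem_singularEdges_iff`). At such an edge, all faces lie in the plane of `F` or in the plane
through the incenters of the tetrahedra at `F`, which contains the split point. At any other edge
three planes are exhibited, told apart by affine functions built from barycentric coordinates.

*Counting.* Over a face `F` in `∂Ω` there are three tetrahedra of the refinement, and the conditions
say that the three values agree: one degree of freedom. Over a face shared by two tetrahedra there
are three pairs of tetrahedra of the refinement, one for each edge of `F`, and the conditions say
that the difference of the two values is the same for the three pairs (`mem_pressureSpace_iff`): four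
degrees of freedom. The linear map `ofParameters` makes this an isomorphism of the pressure space
with a space of functions on a finite set.
-/

namespace WorseyFarin

open scoped Classical

/-! ### Barycentric coordinates -/

/-- The open simplex spanned by a finite set of points: the convex combinations with all weights
positive. For affinely independent points it is the relative interior of the convex hull. -/
def openSimplex (s : Finset Point) : Set Point :=
  {p | ∃ w : Point → ℝ, (∀ v ∈ s, 0 < w v) ∧ ∑ v ∈ s, w v = 1 ∧ ∑ v ∈ s, w v • v = p}

theorem openSimplex_subset_convexHull (s : Finset Point) :
    openSimplex s ⊆ convexHull ℝ (s : Set Point) := by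
  rintro p ⟨w, hw, h1, hp⟩
  exact Finset.mem_convexHull'.2 ⟨w, fun v hv => (hw v hv).le, h1, hp⟩

theorem mem_openSimplex_singleton (v : Point) : v ∈ openSimplex {v} :=
  ⟨fun _ => 1, by simp, by simp, by simp⟩

theorem affineMap_sum (l : Point →ᵃ[ℝ] ℝ) (s : Finset Point) (w : Point → ℝ)
    (h1 : ∑ v ∈ s, w v = 1) : l (∑ v ∈ s, w v • v) = ∑ v ∈ s, w v * l v := by
  have h (x : Point) : l x = l.linear x + l 0 := by
    have := congrFun l.decomp x
    simpa using this
  rw [h, map_sum]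
  have h2 : l 0 = ∑ v ∈ s, w v * l 0 := by rw [← Finset.sum_mul, h1, one_mul]
  nth_rewrite 1 [h2]
  rw [← Finset.sum_add_distrib]
  refine Finset.sum_congr rfl fun v _ => ?_
  rw [h v, map_smul, smul_eq_mul, mul_add]

theorem weights_unique {s : Finset Point} (hs : AffineIndependent ℝ ((↑) : s → Point))
    {w w' : Point → ℝ} (h1 : ∑ v ∈ s, w v = ∑ v ∈ s, w' v)
    (h2 : ∑ v ∈ s, w v • v = ∑ v ∈ s, w' v • v) : ∀ v ∈ s, w v = w' v := by
  intro v hv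
  have := affineIndependent_iff.1 hs Finset.univ (fun v => w v - w' v)
    (by
      rw [Finset.sum_coe_sort s (fun v => w v - w' v), Finset.sum_sub_distrib, h1, sub_self])
    (by
      rw [Finset.sum_coe_sort s (fun v => (w v - w' v) • v)]
      simp only [sub_smul, Finset.sum_sub_distrib, h2, sub_self]) ⟨v, hv⟩ (Finset.mem_univ _)
  exact sub_eq_zero.1 this

/-- `l v`, for `v ∈ T`, are the barycentric coordinates with respect to the vertex set `T` of a
tetrahedron. -/
structure IsCoord (T : Finset Point) (l : Point → Point →ᵃ[ℝ] ℝ) : Prop where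
  self : ∀ v ∈ T, l v v = 1
  ne : ∀ u ∈ T, ∀ v ∈ T, u ≠ v → l v u = 0
  sum_eq : ∀ p, ∑ v ∈ T, l v p = 1
  sum_smul : ∀ p, ∑ v ∈ T, l v p • v = p

theorem exists_isCoord {T : Finset Point} (hT : AffineIndependent ℝ ((↑) : T → Point))
    (h4 : T.card = 4) : ∃ l, IsCoord T l := by
  have htot : affineSpan ℝ (Set.range ((↑) : T → Point)) = ⊤ := by
    rw [hT.affineSpan_eq_top_iff_card_eq_finrank_add_one]
    simp [h4]
  let b : AffineBasis T ℝ Point := ⟨(↑), hT, htot⟩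
  have hb (v : T) : b v = v := rfl
  refine ⟨fun v => if h : v ∈ T then b.coord ⟨v, h⟩ else 0, ?_, ?_, ?_, ?_⟩
  · intro v hv
    simp only [hv, dif_pos]
    exact b.coord_apply_eq ⟨v, hv⟩
  · intro u hu v hv huv
    simp only [hv, dif_pos]
    exact b.coord_apply_ne (i := ⟨v, hv⟩) (j := ⟨u, hu⟩) (fun h => huv (congrArg Subtype.val h).symm)
  · intro p
    rw [← b.sum_coord_apply_eq_one p, ← Finset.sum_coe_sort]
    exact Finset.sum_congr rfl fun v _ => by simp
  · intro p
    conv_rhs => rw [← b.linear_combination_coord_eq_self p]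
    rw [← Finset.sum_coe_sort]
    exact Finset.sum_congr rfl fun v _ => by simp [hb]

namespace IsCoord

variable {T F : Finset Point} {l : Point → Point →ᵃ[ℝ] ℝ} {p : Point}

theorem sum_apply (hl : IsCoord T l) (hF : F ⊆ T) {w : Point → ℝ} (h1 : ∑ v ∈ F, w v = 1)
    {v : Point} (hv : v ∈ T) : l v (∑ u ∈ F, w u • u) = if v ∈ F then w v else 0 := by
  rw [affineMap_sum _ _ _ h1]
  have : ∀ u ∈ F, w u * l v u = if u = v then w u else 0 := by
    intro u hu
    split_ifs with h
    · rw [h, hl.self v hv, mul_one]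
    · rw [hl.ne u (hF hu) v hv h, mul_zero]
  rw [Finset.sum_congr rfl this, Finset.sum_ite_eq']

theorem eq_zero_of_mem_convexHull (hl : IsCoord T l) (hF : F ⊆ T)
    (hp : p ∈ convexHull ℝ (F : Set Point)) {v : Point} (hv : v ∈ T) (hvF : v ∉ F) :
    l v p = 0 := by
  obtain ⟨w, -, h1, rfl⟩ := Finset.mem_convexHull'.1 hp
  rw [hl.sum_apply hF h1 hv, if_neg hvF]

theorem pos_of_mem_openSimplex (hl : IsCoord T l) (hF : F ⊆ T) (hp : p ∈ openSimplex F)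
    {v : Point} (hv : v ∈ F) : 0 < l v p := by
  obtain ⟨w, hw, h1, rfl⟩ := hp
  rw [hl.sum_apply hF h1 (hF hv), if_pos hv]
  exact hw v hv

theorem eq_zero_of_mem_openSimplex (hl : IsCoord T l) (hF : F ⊆ T) (hp : p ∈ openSimplex F)
    {v : Point} (hv : v ∈ T) (hvF : v ∉ F) : l v p = 0 :=
  hl.eq_zero_of_mem_convexHull hF (openSimplex_subset_convexHull F hp) hv hvF

theorem mem_openSimplex (hl : IsCoord T l) (hF : F ⊆ T) (h : ∀ v ∈ F, 0 < l v p)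
    (h0 : ∀ v ∈ T, v ∉ F → l v p = 0) : p ∈ openSimplex F := by
  refine ⟨fun v => l v p, h, ?_, ?_⟩
  · rw [← hl.sum_eq p]
    exact Finset.sum_subset hF h0
  · conv_rhs => rw [← hl.sum_smul p]
    exact Finset.sum_subset hF fun v hv hvF => by
      simp only [h0 v hv hvF, zero_smul]

theorem mem_convexHull_iff (hl : IsCoord T l) :
    p ∈ convexHull ℝ (T : Set Point) ↔ ∀ v ∈ T, 0 ≤ l v p := by
  constructor
  · intro hp v hv
    obtain ⟨w, hw, h1, rfl⟩ := Finset.mem_convexHull'.1 hp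
    rw [hl.sum_apply subset_rfl h1 hv, if_pos hv]
    exact hw v hv
  · intro h
    exact Finset.mem_convexHull'.2 ⟨fun v => l v p, h, hl.sum_eq p, hl.sum_smul p⟩

end IsCoord

variable {𝒯 : Geometry.SimplicialComplex ℝ Point} {Ω : Set Point}

/-- If the open simplex on `s` meets the closed simplex on `t`, then `s` is a face of `t`. This is
what tells apart the vertices, incenters and split points: each lies in a single open simplex. -/
theorem subset_of_mem_openSimplex {s t : Finset Point} (hs : s ∈ 𝒯.faces) (ht : t ∈ 𝒯.faces)
    {p : Point} (hps : p ∈ openSimplex s) (hpt : p ∈ convexHull ℝ (t : Set Point)) : s ⊆ t := by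
  have h := 𝒯.inter_subset_convexHull hs ht ⟨openSimplex_subset_convexHull s hps, hpt⟩
  rw [← Finset.coe_inter] at h
  obtain ⟨w', -, h1', hp'⟩ := Finset.mem_convexHull'.1 h
  obtain ⟨w, hw, h1, hp⟩ := hps
  have key := weights_unique (𝒯.indep hs) (w := w)
    (w' := fun v => if v ∈ t then w' v else 0)
    (by rw [h1, ← h1', ← Finset.sum_filter, Finset.filter_mem_eq_inter])
    (by simp only [hp, ← hp', ite_smul, zero_smul]
        rw [← Finset.sum_filter, Finset.filter_mem_eq_inter])
  intro v hv
  by_contra hvt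
  have h2 := key v hv
  rw [if_neg hvt] at h2
  exact (hw v hv).ne' h2

theorem eq_of_mem_openSimplex {s t : Finset Point} (hs : s ∈ 𝒯.faces) (ht : t ∈ 𝒯.faces)
    {p : Point} (hps : p ∈ openSimplex s) (hpt : p ∈ openSimplex t) : s = t :=
  (subset_of_mem_openSimplex hs ht hps (openSimplex_subset_convexHull t hpt)).antisymm
    (subset_of_mem_openSimplex ht hs hpt (openSimplex_subset_convexHull s hps))

/-! ### Incenters and touch points -/

theorem exists_simplex {T : Finset Point} (hT : AffineIndependent ℝ ((↑) : T → Point))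
    (h4 : T.card = 4) : ∃ S : Affine.Simplex ℝ Point 3, Set.range S.points = (T : Set Point) := by
  let e : Fin 4 ≃ T := (T.equivFinOfCardEq h4).symm
  have hi : AffineIndependent ℝ (fun i : Fin 4 => (e i : Point)) :=
    hT.comp_embedding e.toEmbedding
  refine ⟨⟨fun i => (e i : Point), hi⟩, ?_⟩
  ext x
  refine ⟨?_, fun hx => ⟨e.symm ⟨x, hx⟩, ?_⟩⟩
  · rintro ⟨i, rfl⟩
    exact (e i).2
  · show ((e (e.symm ⟨x, hx⟩) : T) : Point) = x
    rw [e.apply_symm_apply]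

theorem IsCoord.affineCombination {T : Finset Point} {l : Point → Point →ᵃ[ℝ] ℝ}
    (hl : IsCoord T l) {S : Affine.Simplex ℝ Point 3} (hS : Set.range S.points = (T : Set Point))
    {w : Fin 4 → ℝ} (h1 : ∑ i, w i = 1) (i : Fin 4) :
    l (S.points i) (Finset.univ.affineCombination ℝ S.points w) = w i := by
  have hmem (j : Fin 4) : S.points j ∈ T := by
    have : S.points j ∈ (T : Set Point) := hS ▸ Set.mem_range_self j
    exact this
  rw [Finset.map_affineCombination _ _ _ h1, Finset.affineCombination_eq_linear_combination _ _ _ h1,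
    Finset.sum_eq_single i]
  · simp [hl.self _ (hmem i)]
  · intro j _ hj
    simp [hl.ne _ (hmem j) _ (hmem i) (fun h => hj (S.independent.injective h))]
  · simp

theorem incenter_mem_openSimplex {T : Finset Point}
    (hT : AffineIndependent ℝ ((↑) : T → Point)) (h4 : T.card = 4) :
    incenter T ∈ openSimplex T := by
  obtain ⟨S, hS⟩ := exists_simplex hT h4
  obtain ⟨l, hl⟩ := exists_isCoord hT h4
  rw [incenter_eq T S hS]
  have h1 := S.excenterExists_empty.sum_excenterWeights_eq_one
  refine hl.mem_openSimplex subset_rfl (fun v hv => ?_) (fun v hv hv' => absurd hv hv')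
  obtain ⟨i, rfl⟩ : v ∈ Set.range S.points := hS ▸ hv
  rw [S.incenter_eq_affineCombination, hl.affineCombination hS h1]
  exact S.excenterWeights_empty_pos i

/-- The insphere of a tetrahedron touches each face at a point of the relative interior of the
face, which is the orthogonal projection of the incenter. -/
theorem exists_touchpoint {T F : Finset Point} {a : Point}
    (hT : AffineIndependent ℝ ((↑) : T → Point)) (h4 : T.card = 4) (ha : a ∉ F)
    (haF : insert a F = T) :
    ∃ t ∈ openSimplex F, ∀ x ∈ F, ∀ y ∈ F, inner ℝ (x - y) (incenter T - t) = 0 := by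
  obtain ⟨S, hS⟩ := exists_simplex hT h4
  obtain ⟨l, hl⟩ := exists_isCoord hT h4
  have haT : a ∈ T := haF ▸ Finset.mem_insert_self a F
  obtain ⟨i, rfl⟩ : a ∈ Set.range S.points := hS ▸ haT
  have hFT : F ⊆ T := haF ▸ Finset.subset_insert _ F
  have hF (v : Point) (hv : v ∈ F) : ∃ j, j ≠ i ∧ S.points j = v := by
    obtain ⟨j, rfl⟩ : v ∈ Set.range S.points := hS ▸ hFT hv
    exact ⟨j, fun h => ha (h ▸ hv), rfl⟩
  refine ⟨S.touchpoint ∅ i, ?_, ?_⟩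
  · rw [← S.affineCombination_touchpointWeights]
    refine hl.mem_openSimplex hFT (fun v hv => ?_) (fun v hv hvF => ?_)
    · obtain ⟨j, hj, rfl⟩ := hF v hv
      rw [hl.affineCombination hS (S.sum_touchpointWeights _ _)]
      exact S.touchpointWeights_empty_pos hj.symm
    · have : v = S.points i := by
        rw [← haF, Finset.mem_insert] at hv
        exact hv.resolve_right hvF
      rw [this, hl.affineCombination hS (S.sum_touchpointWeights _ _)]
      simp
  · intro x hx y hy
    have hmem (z : Point) (hz : z ∈ F) :
        z ∈ affineSpan ℝ (Set.range (S.faceOpposite i).points) := by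
      obtain ⟨j, hj, rfl⟩ := hF z hz
      exact (S.points_mem_affineSpan_faceOpposite).2 hj
    have h := EuclideanGeometry.vsub_orthogonalProjection_mem_direction_orthogonal
      (affineSpan ℝ (Set.range (S.faceOpposite i).points)) S.incenter
    rw [incenter_eq T S hS]
    exact (Submodule.mem_orthogonal _ _).1 h (x - y)
      (AffineSubspace.vsub_mem_direction (hmem x hx) (hmem y hy))

/-! ### Adjacent tetrahedra -/

/-- An affine function vanishing on a face is a multiple of the barycentric coordinate of the
opposite vertex. -/
theorem IsCoord.eq_mul_of_vanish {T F : Finset Point} {l : Point → Point →ᵃ[ℝ] ℝ} {b : Point}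
    (hl : IsCoord T l) (hb : b ∉ F) (hbF : insert b F = T) (f : Point →ᵃ[ℝ] ℝ)
    (hf : ∀ v ∈ F, f v = 0) (p : Point) : f p = f b * l b p := by
  conv_lhs => rw [← hl.sum_smul p]
  rw [affineMap_sum f T _ (hl.sum_eq p), ← hbF, Finset.sum_insert hb,
    Finset.sum_eq_zero fun v hv => by rw [hf v hv, mul_zero], add_zero, mul_comm]

theorem exists_insert_eq {T F : Finset Point} (h4 : T.card = 4) (h3 : F.card = 3) (h : F ⊆ T) :
    ∃ a, a ∉ F ∧ insert a F = T := by
  have := (Finset.exists_eq_insert_iff (s := F) (t := T)).2 ⟨h, by omega⟩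
  obtain ⟨a, ha, h⟩ := this
  exact ⟨a, ha, h⟩

theorem centroid_mem_openSimplex {F : Finset Point} (hF : F.Nonempty) :
    F.centroid ℝ id ∈ openSimplex F := by
  have h1 : ∑ v ∈ F, F.centroidWeights ℝ v = 1 :=
    F.sum_centroidWeights_eq_one_of_nonempty ℝ hF
  refine ⟨F.centroidWeights ℝ, fun v _ => ?_, h1, ?_⟩
  · simp only [Finset.centroidWeights, Function.const_apply, inv_pos, Nat.cast_pos]
    exact hF.card_pos
  · rw [Finset.centroid, Finset.affineCombination_eq_linear_combination _ _ _ h1]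
    simp

/-- The apexes of two tetrahedra of a complex over a common face lie strictly on opposite sides of
the plane of the face: otherwise a point of the second one close to the face would lie in the
first one. -/
theorem coord_apex_neg {T₁ T₂ F : Finset Point} (h₁ : T₁ ∈ tetrahedra 𝒯) (h₂ : T₂ ∈ tetrahedra 𝒯)
    (hne : T₁ ≠ T₂) (h3 : F.card = 3) {a b : Point} (ha : a ∉ F) (haF : insert a F = T₁)
    (hb : b ∉ F) (hbF : insert b F = T₂) {l : Point → Point →ᵃ[ℝ] ℝ} (hl : IsCoord T₁ l) :
    l a b < 0 := by
  by_contra! hab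
  have hF1 : F ⊆ T₁ := haF ▸ Finset.subset_insert _ F
  have hF2 : F ⊆ T₂ := hbF ▸ Finset.subset_insert _ F
  have hb2 : b ∈ T₂ := hbF ▸ Finset.mem_insert_self b F
  obtain ⟨l', hl'⟩ := exists_isCoord (𝒯.indep h₂.1) h₂.2
  have hFn : F.Nonempty := Finset.card_pos.1 (by omega)
  have hg := centroid_mem_openSimplex hFn
  set g := F.centroid ℝ id
  have hev : ∀ᶠ ε in nhdsWithin (0 : ℝ) (Set.Ioi 0),
      ∀ v ∈ F, 0 < l v (AffineMap.lineMap g b ε) := by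
    refine (Filter.eventually_all_finset F).2 fun v hv => ?_
    have hc : Continuous fun ε : ℝ => l v (AffineMap.lineMap g b ε) :=
      (l v).continuous_of_finiteDimensional.comp AffineMap.lineMap_continuous
    refine (hc.continuousAt.eventually_mem (s := Set.Ioi 0) ?_).filter_mono nhdsWithin_le_nhds
    refine Ioi_mem_nhds ?_
    rw [AffineMap.lineMap_apply_zero]
    exact hl.pos_of_mem_openSimplex hF1 hg hv
  obtain ⟨ε, hε, hε0, hε1⟩ := (hev.and (Ioo_mem_nhdsGT (zero_lt_one' ℝ))).exists
  have hp1 : AffineMap.lineMap g b ε ∈ convexHull ℝ (T₁ : Set Point) := by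
    rw [hl.mem_convexHull_iff]
    intro v hv
    rw [← haF, Finset.mem_insert] at hv
    obtain rfl | hv := hv
    · rw [AffineMap.apply_lineMap, AffineMap.lineMap_apply_ring,
        hl.eq_zero_of_mem_openSimplex hF1 hg (haF ▸ Finset.mem_insert_self _ F) ha]
      nlinarith
    · exact (hε v hv).le
  have hp2 : AffineMap.lineMap g b ε ∈ openSimplex T₂ := by
    refine hl'.mem_openSimplex subset_rfl (fun v hv => ?_) (fun v hv hv' => absurd hv hv')
    rw [AffineMap.apply_lineMap, AffineMap.lineMap_apply_ring]
    rw [← hbF, Finset.mem_insert] at hv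
    obtain rfl | hv := hv
    · rw [hl'.self v hb2, hl'.eq_zero_of_mem_openSimplex hF2 hg hb2 hb]
      linarith
    · have := hl'.pos_of_mem_openSimplex hF2 hg hv
      rw [hl'.ne b hb2 v (hF2 hv) (fun h => hb (h ▸ hv))]
      have : 0 < (1 - ε) * l' v g := mul_pos (by linarith) this
      linarith
  have hsub := subset_of_mem_openSimplex h₂.1 h₁.1 hp2 hp1
  exact hne (Finset.eq_of_subset_of_card_le hsub (by rw [h₁.2, h₂.2])).symm

/-- At most two tetrahedra of a complex in `ℝ³` share a face. -/
theorem eq_or_eq_of_face_subset {T₁ T₂ T₃ F : Finset Point} (h₁ : T₁ ∈ tetrahedra 𝒯)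
    (h₂ : T₂ ∈ tetrahedra 𝒯) (h₃ : T₃ ∈ tetrahedra 𝒯) (hne : T₁ ≠ T₂) (h3 : F.card = 3)
    (hF1 : F ⊆ T₁) (hF2 : F ⊆ T₂) (hF3 : F ⊆ T₃) : T₃ = T₁ ∨ T₃ = T₂ := by
  by_contra! h
  obtain ⟨a, ha, haF⟩ := exists_insert_eq h₁.2 h3 hF1
  obtain ⟨b, hb, hbF⟩ := exists_insert_eq h₂.2 h3 hF2
  obtain ⟨d, hd, hdF⟩ := exists_insert_eq h₃.2 h3 hF3
  obtain ⟨l, hl⟩ := exists_isCoord (𝒯.indep h₁.1) h₁.2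
  obtain ⟨l', hl'⟩ := exists_isCoord (𝒯.indep h₂.1) h₂.2
  have h12 := coord_apex_neg h₁ h₂ hne h3 ha haF hb hbF hl
  have h13 := coord_apex_neg h₁ h₃ h.1.symm h3 ha haF hd hdF hl
  have h23 := coord_apex_neg h₂ h₃ h.2.symm h3 hb hbF hd hdF hl'
  have key := hl'.eq_mul_of_vanish hb hbF (l a)
    (fun v hv => hl.ne v (hF1 hv) a (haF ▸ Finset.mem_insert_self a F) (fun h => ha (h ▸ hv))) d
  have := mul_pos_of_neg_of_neg h12 h23
  linarith

/-- Two tetrahedra of `𝒯` have the face `F` in common. -/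
def IsShared (𝒯 : Geometry.SimplicialComplex ℝ Point) (F : Finset Point) : Prop :=
  ∃ T₁ ∈ tetrahedra 𝒯, ∃ T₂ ∈ tetrahedra 𝒯, T₁ ≠ T₂ ∧ F ⊆ T₁ ∧ F ⊆ T₂

/-- A point of the open face common to two tetrahedra has a neighborhood covered by them. -/
theorem openSimplex_subset_interior_space {F : Finset Point} (h3 : F.card = 3)
    (hF : IsShared 𝒯 F) : openSimplex F ⊆ interior 𝒯.space := by
  obtain ⟨T₁, h₁, T₂, h₂, hne, hF1, hF2⟩ := hF
  obtain ⟨a, ha, haF⟩ := exists_insert_eq h₁.2 h3 hF1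
  obtain ⟨b, hb, hbF⟩ := exists_insert_eq h₂.2 h3 hF2
  obtain ⟨l, hl⟩ := exists_isCoord (𝒯.indep h₁.1) h₁.2
  obtain ⟨l', hl'⟩ := exists_isCoord (𝒯.indep h₂.1) h₂.2
  have h12 := coord_apex_neg h₁ h₂ hne h3 ha haF hb hbF hl
  intro p hp
  have hev (T : Finset Point) (l : Point → Point →ᵃ[ℝ] ℝ) (hl : IsCoord T l) (hFT : F ⊆ T) :
      ∀ᶠ x in nhds p, ∀ v ∈ F, 0 < l v x := by
    refine (Filter.eventually_all_finset F).2 fun v hv => ?_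
    exact (l v).continuous_of_finiteDimensional.continuousAt.eventually_mem
      (Ioi_mem_nhds (hl.pos_of_mem_openSimplex hFT hp hv))
  rw [mem_interior_iff_mem_nhds]
  filter_upwards [hev T₁ l hl hF1, hev T₂ l' hl' hF2] with x hx hx'
  by_cases h0 : 0 ≤ l a x
  · refine 𝒯.convexHull_subset_space h₁.1 (hl.mem_convexHull_iff.2 fun v hv => ?_)
    rw [← haF, Finset.mem_insert] at hv
    obtain rfl | hv := hv
    · exact h0
    · exact (hx v hv).le
  · refine 𝒯.convexHull_subset_space h₂.1 (hl'.mem_convexHull_iff.2 fun v hv => ?_)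
    rw [← hbF, Finset.mem_insert] at hv
    obtain rfl | hv := hv
    · have key := hl'.eq_mul_of_vanish hb hbF (l a) (fun u hu =>
        hl.ne u (hF1 hu) a (haF ▸ Finset.mem_insert_self a F) (fun h => ha (h ▸ hu))) x
      by_contra! hneg
      have := mul_pos_of_neg_of_neg h12 hneg
      exact h0 (key ▸ this.le)
    · exact (hx' v hv).le

theorem openSimplex_tetrahedron_subset_interior_space {T : Finset Point}
    (hT : T ∈ tetrahedra 𝒯) : openSimplex T ⊆ interior 𝒯.space := by
  obtain ⟨l, hl⟩ := exists_isCoord (𝒯.indep hT.1) hT.2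
  intro p hp
  rw [mem_interior_iff_mem_nhds]
  have hev : ∀ᶠ x in nhds p, ∀ v ∈ T, 0 < l v x := by
    refine (Filter.eventually_all_finset T).2 fun v hv => ?_
    exact (l v).continuous_of_finiteDimensional.continuousAt.eventually_mem
      (Ioi_mem_nhds (hl.pos_of_mem_openSimplex subset_rfl hp hv))
  filter_upwards [hev] with x hx
  exact 𝒯.convexHull_subset_space hT.1 (hl.mem_convexHull_iff.2 fun v hv => (hx v hv).le)

theorem lineMap_mem_openSimplex {s t : Finset Point} (hst : s ⊆ t) {p q : Point}
    (hp : p ∈ convexHull ℝ (s : Set Point)) (hq : q ∈ openSimplex t) {ε : ℝ} (h0 : 0 < ε)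
    (h1 : ε ≤ 1) : AffineMap.lineMap p q ε ∈ openSimplex t := by
  obtain ⟨w, hw, hw1, rfl⟩ :=
    Finset.mem_convexHull'.1 (convexHull_mono (Finset.coe_subset.2 hst) hp)
  obtain ⟨w', hw', hw1', rfl⟩ := hq
  refine ⟨fun v => (1 - ε) * w v + ε * w' v, fun v hv => ?_, ?_, ?_⟩
  · have := mul_nonneg (sub_nonneg.2 h1) (hw v hv)
    have := mul_pos h0 (hw' v hv)
    linarith
  · rw [Finset.sum_add_distrib, ← Finset.mul_sum, ← Finset.mul_sum, hw1, hw1']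
    ring
  · rw [AffineMap.lineMap_apply_module]
    simp only [add_smul, mul_smul, Finset.sum_add_distrib, Finset.smul_sum]

theorem convexHull_subset_closure_openSimplex {s t : Finset Point} (hst : s ⊆ t)
    (ht : t.Nonempty) : convexHull ℝ (s : Set Point) ⊆ closure (openSimplex t) := by
  intro p hp
  have hq := centroid_mem_openSimplex ht
  set q := t.centroid ℝ id
  have hc : Filter.Tendsto (fun ε : ℝ => AffineMap.lineMap p q ε) (nhdsWithin 0 (Set.Ioi 0))
      (nhds p) := by
    have := (AffineMap.lineMap_continuous (p := p) (q := q) (R := ℝ)).tendsto 0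
    rw [AffineMap.lineMap_apply_zero] at this
    exact this.mono_left nhdsWithin_le_nhds
  refine mem_closure_of_tendsto hc ?_
  filter_upwards [Ioo_mem_nhdsGT (zero_lt_one' ℝ)] with ε hε
  exact lineMap_mem_openSimplex hst hp hq hε.1 hε.2.le

/-- A face of a single tetrahedron lies on the boundary: beyond an interior point of the face
there would have to be another tetrahedron, which would then contain the face. -/
theorem convexHull_subset_frontier (h𝒯 : IsTriangulation 𝒯 Ω) {F : Finset Point}
    (hF : F ∈ 𝒯.faces) (h3 : F.card = 3) (hns : ¬ IsShared 𝒯 F) :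
    convexHull ℝ (F : Set Point) ⊆ frontier Ω := by
  obtain ⟨T, hT, hFT⟩ := h𝒯.pure F hF
  have hFn : F.Nonempty := 𝒯.nonempty_of_mem_faces hF
  suffices h : openSimplex F ⊆ frontier Ω from
    (convexHull_subset_closure_openSimplex subset_rfl hFn).trans
      (closure_minimal h isClosed_frontier)
  intro p hp
  have hpH := openSimplex_subset_convexHull F hp
  refine ⟨?_, ?_⟩
  · rw [← h𝒯.interior_space]
    exact closure_mono (openSimplex_tetrahedron_subset_interior_space hT)
      (convexHull_subset_closure_openSimplex hFT (hFn.mono hFT) hpH)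
  · rw [← h𝒯.interior_space, interior_interior]
    intro hpi
    obtain ⟨a, ha, haF⟩ := exists_insert_eq hT.2 h3 hFT
    have haT : a ∈ T := haF ▸ Finset.mem_insert_self a F
    obtain ⟨l, hl⟩ := exists_isCoord (𝒯.indep hT.1) hT.2
    -- Near `p` the complex contains no points of simplices that are not faces of `T`.
    have hev : ∀ᶠ x in nhds p, ∀ s ∈ 𝒯.faces, ¬ s ⊆ T → x ∉ convexHull ℝ (s : Set Point) := by
      rw [Filter.eventually_all_finite h𝒯.finite_faces]
      intro s hs
      by_cases hsT : s ⊆ T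
      · exact Filter.Eventually.of_forall fun x h => absurd hsT h
      · have hcl : IsClosed (convexHull ℝ (s : Set Point)) :=
          (s.finite_toSet.isCompact_convexHull (𝕜 := ℝ)).isClosed
        have hps : p ∉ convexHull ℝ (s : Set Point) := by
          intro hps
          have hFs := subset_of_mem_openSimplex hF hs hp hps
          obtain ⟨T', hT', hsT'⟩ := h𝒯.pure s hs
          exact hns ⟨T, hT, T', hT', fun h => hsT (h ▸ hsT'), hFT, hFs.trans hsT'⟩
        filter_upwards [hcl.isOpen_compl.mem_nhds hps] with x hx _ using hx
    have hc : Filter.Tendsto (fun ε : ℝ => AffineMap.lineMap p a ε) (nhdsWithin 0 (Set.Iio 0))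
        (nhds p) := by
      have := (AffineMap.lineMap_continuous (p := p) (q := a) (R := ℝ)).tendsto 0
      rw [AffineMap.lineMap_apply_zero] at this
      exact this.mono_left nhdsWithin_le_nhds
    -- A point beyond `p`, seen from `a`, is in the complex but not in `T`.
    obtain ⟨ε, ⟨hε1, hε2⟩, hε⟩ := ((hc.eventually (hev.and
      (mem_interior_iff_mem_nhds.1 hpi))).and self_mem_nhdsWithin).exists
    obtain ⟨s, hs, hxs⟩ := Geometry.SimplicialComplex.mem_space_iff.1 hε2
    have hsT : s ⊆ T := by
      by_contra hsT
      exact hε1 s hs hsT hxs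
    have h0 := hl.mem_convexHull_iff.1 (convexHull_mono (Finset.coe_subset.2 hsT) hxs) a haT
    rw [AffineMap.apply_lineMap, AffineMap.lineMap_apply_ring, hl.self a haT,
      hl.eq_zero_of_mem_openSimplex hFT hp haT ha] at h0
    have : ε < 0 := hε
    linarith

/-! ### Face split points -/

theorem isTriangulation_isOpen (h𝒯 : IsTriangulation 𝒯 Ω) : IsOpen Ω :=
  h𝒯.interior_space ▸ isOpen_interior

/-- The incenters of two tetrahedra with a common face are separated by the plane of the face. The
last clause says that the zero set of the separating function is no larger than that plane. -/
theorem exists_separating {T₁ T₂ F : Finset Point} (h₁ : T₁ ∈ tetrahedra 𝒯)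
    (h₂ : T₂ ∈ tetrahedra 𝒯) (hne : T₁ ≠ T₂) (h3 : F.card = 3) (hF1 : F ⊆ T₁) (hF2 : F ⊆ T₂) :
    ∃ f : Point →ᵃ[ℝ] ℝ, (∀ x ∈ convexHull ℝ (F : Set Point), f x = 0) ∧
      0 < f (incenter T₁) ∧ f (incenter T₂) < 0 ∧
      ∀ p, f p = 0 → ∃ w : Point → ℝ, ∑ v ∈ F, w v = 1 ∧ ∑ v ∈ F, w v • v = p := by
  obtain ⟨a, ha, haF⟩ := exists_insert_eq h₁.2 h3 hF1
  obtain ⟨b, hb, hbF⟩ := exists_insert_eq h₂.2 h3 hF2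
  have haT : a ∈ T₁ := haF ▸ Finset.mem_insert_self a F
  have hbT : b ∈ T₂ := hbF ▸ Finset.mem_insert_self b F
  obtain ⟨l, hl⟩ := exists_isCoord (𝒯.indep h₁.1) h₁.2
  obtain ⟨l', hl'⟩ := exists_isCoord (𝒯.indep h₂.1) h₂.2
  refine ⟨l a, fun x hx => hl.eq_zero_of_mem_convexHull hF1 hx haT ha,
    hl.pos_of_mem_openSimplex subset_rfl (incenter_mem_openSimplex (𝒯.indep h₁.1) h₁.2) haT,
    ?_, fun p hp => ⟨fun v => l v p, ?_, ?_⟩⟩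
  · rw [hl'.eq_mul_of_vanish hb hbF (l a)
      (fun v hv => hl.ne v (hF1 hv) a haT (fun h => ha (h ▸ hv)))]
    exact mul_neg_of_neg_of_pos (coord_apex_neg h₁ h₂ hne h3 ha haF hb hbF hl)
      (hl'.pos_of_mem_openSimplex subset_rfl (incenter_mem_openSimplex (𝒯.indep h₂.1) h₂.2) hbT)
  · have := hl.sum_eq p
    rwa [← haF, Finset.sum_insert ha, hp, zero_add] at this
  · have := hl.sum_smul p
    rwa [← haF, Finset.sum_insert ha, hp, zero_smul, zero_add] at this

/-- The segment joining the incenters of two adjacent tetrahedra meets the relative interior of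
their common face. Indeed the two radii of the inspheres at their touch points on that face are
orthogonal to it and point to opposite sides, so the segment of the incenters meets the face where
it meets the segment of the touch points. -/
theorem exists_mem_segment_incenter {T₁ T₂ F : Finset Point} (h₁ : T₁ ∈ tetrahedra 𝒯)
    (h₂ : T₂ ∈ tetrahedra 𝒯) (hne : T₁ ≠ T₂) (h3 : F.card = 3) (hF1 : F ⊆ T₁) (hF2 : F ⊆ T₂) :
    ∃ m ∈ segment ℝ (incenter T₁) (incenter T₂), m ∈ openSimplex F := by
  obtain ⟨f, hf0, hf1, hf2, hfp⟩ := exists_separating h₁ h₂ hne h3 hF1 hF2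
  obtain ⟨a, ha, haF⟩ := exists_insert_eq h₁.2 h3 hF1
  obtain ⟨b, hb, hbF⟩ := exists_insert_eq h₂.2 h3 hF2
  obtain ⟨t₁, ht₁, ho₁⟩ := exists_touchpoint (𝒯.indep h₁.1) h₁.2 ha haF
  obtain ⟨t₂, ht₂, ho₂⟩ := exists_touchpoint (𝒯.indep h₂.1) h₂.2 hb hbF
  set c₁ := incenter T₁
  set c₂ := incenter T₂
  have hsub (x y : Point) : f.linear (x - y) = f x - f y := f.linearMap_vsub x y
  have hft₁ := hf0 t₁ (openSimplex_subset_convexHull F ht₁)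
  have hft₂ := hf0 t₂ (openSimplex_subset_convexHull F ht₂)
  set s := f c₁
  set r := -f c₂ with hr
  have hr0 : 0 < r := by linarith
  -- The vector `w` is orthogonal to the plane of `F` and parallel to it, hence zero.
  set w : Point := s • (c₂ - t₂) + r • (c₁ - t₁) with hw
  have hwker : f.linear w = 0 := by
    rw [hw, map_add, map_smul, map_smul, hsub, hsub, hft₁, hft₂, smul_eq_mul, smul_eq_mul]
    simp only [s, r]
    ring
  have hworth (x : Point) (hx : x ∈ F) (y : Point) (hy : y ∈ F) : inner ℝ (x - y) w = 0 := by
    rw [hw, inner_add_right, inner_smul_right, inner_smul_right, ho₁ x hx y hy, ho₂ x hx y hy]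
    simp
  obtain ⟨q, hq⟩ : F.Nonempty := Finset.card_pos.1 (by omega)
  have hw0 : w = 0 := by
    have hqw : f (w + q) = 0 := by
      have h := f.map_vadd q w
      rw [vadd_eq_add, vadd_eq_add, hwker,
        hf0 q (subset_convexHull ℝ _ (Finset.mem_coe.2 hq)), add_zero] at h
      exact h
    obtain ⟨g, hg1, hg⟩ := hfp _ hqw
    have hwsum : w = ∑ v ∈ F, g v • (v - q) := by
      simp only [smul_sub, Finset.sum_sub_distrib, hg, ← Finset.sum_smul, hg1, one_smul,
        add_sub_cancel_right]
    have : inner ℝ w w = 0 := by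
      nth_rewrite 1 [hwsum]
      rw [sum_inner]
      refine Finset.sum_eq_zero fun v hv => ?_
      rw [inner_smul_left, hworth v hv q hq, mul_zero]
    exact inner_self_eq_zero.1 this
  have hsr : 0 < s + r := by linarith
  have h0 : 0 < s / (s + r) := div_pos hf1 hsr
  have h1 : s / (s + r) ≤ 1 := (div_le_one hsr).2 (by linarith)
  refine ⟨AffineMap.lineMap c₁ c₂ (s / (s + r)), ?_, ?_⟩
  · rw [segment_eq_image_lineMap]
    exact ⟨_, ⟨h0.le, h1⟩, rfl⟩
  · have : AffineMap.lineMap c₁ c₂ (s / (s + r)) = AffineMap.lineMap t₁ t₂ (s / (s + r)) := by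
      have key : AffineMap.lineMap c₁ c₂ (s / (s + r)) - AffineMap.lineMap t₁ t₂ (s / (s + r))
          = (s + r)⁻¹ • w := by
        have e1 : 1 - s / (s + r) = (s + r)⁻¹ * r := by field_simp; ring
        have e2 : s / (s + r) = (s + r)⁻¹ * s := by field_simp
        rw [AffineMap.lineMap_apply_module, AffineMap.lineMap_apply_module, e1, e2, hw]
        module
      rw [hw0, smul_zero] at key
      exact sub_eq_zero.1 key
    rw [this]
    exact lineMap_mem_openSimplex subset_rfl (openSimplex_subset_convexHull F ht₁) ht₂ h0 h1

theorem segment_incenter_inter_unique {T₁ T₂ F : Finset Point} (h₁ : T₁ ∈ tetrahedra 𝒯)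
    (h₂ : T₂ ∈ tetrahedra 𝒯) (hne : T₁ ≠ T₂) (h3 : F.card = 3) (hF1 : F ⊆ T₁) (hF2 : F ⊆ T₂)
    {m m' : Point} (hm : m ∈ segment ℝ (incenter T₁) (incenter T₂))
    (hmF : m ∈ convexHull ℝ (F : Set Point)) (hm' : m' ∈ segment ℝ (incenter T₁) (incenter T₂))
    (hmF' : m' ∈ convexHull ℝ (F : Set Point)) : m = m' := by
  obtain ⟨f, hf0, hf1, hf2, -⟩ := exists_separating h₁ h₂ hne h3 hF1 hF2
  rw [segment_eq_image_lineMap] at hm hm'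
  obtain ⟨θ, -, rfl⟩ := hm
  obtain ⟨θ', -, rfl⟩ := hm'
  have e := hf0 _ hmF
  have e' := hf0 _ hmF'
  rw [AffineMap.apply_lineMap, AffineMap.lineMap_apply_ring] at e e'
  have : (θ - θ') * (f (incenter T₂) - f (incenter T₁)) = 0 := by linear_combination e - e'
  have h := (mul_eq_zero.1 this).resolve_right (by linarith)
  rw [sub_eq_zero.1 h]

theorem pair_eq_of_isShared {T₁ T₂ T₁' T₂' F : Finset Point} (h₁ : T₁ ∈ tetrahedra 𝒯)
    (h₂ : T₂ ∈ tetrahedra 𝒯) (hne : T₁ ≠ T₂) (h3 : F.card = 3) (hF1 : F ⊆ T₁) (hF2 : F ⊆ T₂)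
    (h₁' : T₁' ∈ tetrahedra 𝒯) (h₂' : T₂' ∈ tetrahedra 𝒯) (hne' : T₁' ≠ T₂') (hF1' : F ⊆ T₁')
    (hF2' : F ⊆ T₂') : (T₁' = T₁ ∧ T₂' = T₂) ∨ (T₁' = T₂ ∧ T₂' = T₁) := by
  rcases eq_or_eq_of_face_subset h₁ h₂ h₁' hne h3 hF1 hF2 hF1' with rfl | rfl <;>
  rcases eq_or_eq_of_face_subset h₁ h₂ h₂' hne h3 hF1 hF2 hF2' with rfl | rfl <;> simp_all

theorem notMem_frontier_of_isShared (h𝒯 : IsTriangulation 𝒯 Ω) {F : Finset Point}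
    (h3 : F.card = 3) (hF : IsShared 𝒯 F) {p : Point} (hp : p ∈ openSimplex F) :
    p ∉ frontier Ω := by
  have hpΩ : p ∈ Ω := h𝒯.interior_space ▸ openSimplex_subset_interior_space h3 hF hp
  rw [(isTriangulation_isOpen h𝒯).frontier_eq]
  exact fun h => h.2 hpΩ

/-- Each face of the triangulation has exactly one split point, and it lies in the relative
interior of the face. -/
theorem exists_isSplitPoint_iff (h𝒯 : IsTriangulation 𝒯 Ω) {F : Finset Point}
    (hF : F ∈ 𝒯.faces) (h3 : F.card = 3) :
    ∃ m ∈ openSimplex F, ∀ m', IsSplitPoint 𝒯 Ω F m' ↔ m' = m := by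
  have hFn : F.Nonempty := 𝒯.nonempty_of_mem_faces hF
  by_cases hS : IsShared 𝒯 F
  · have hS' := hS
    obtain ⟨T₁, h₁, T₂, h₂, hne, hF1, hF2⟩ := hS'
    obtain ⟨m, hm, hmF⟩ := exists_mem_segment_incenter h₁ h₂ hne h3 hF1 hF2
    have hmH := openSimplex_subset_convexHull F hmF
    refine ⟨m, hmF, fun m' => ⟨?_, ?_⟩⟩
    · rintro ⟨-, -, ⟨T₁', h₁', T₂', h₂', hne', hF1', hF2', hm', hmF'⟩ | ⟨hfr, -⟩⟩
      · have hm'' : m' ∈ segment ℝ (incenter T₁) (incenter T₂) := by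
          rcases pair_eq_of_isShared h₁ h₂ hne h3 hF1 hF2 h₁' h₂' hne' hF1' hF2' with
            ⟨rfl, rfl⟩ | ⟨rfl, rfl⟩
          · exact hm'
          · rwa [segment_symm]
        exact segment_incenter_inter_unique h₁ h₂ hne h3 hF1 hF2 hm'' hmF' hm hmH
      · exact absurd (hfr (openSimplex_subset_convexHull F (centroid_mem_openSimplex hFn)))
          (notMem_frontier_of_isShared h𝒯 h3 hS (centroid_mem_openSimplex hFn))
    · rintro rfl
      exact ⟨hF, h3, Or.inl ⟨T₁, h₁, T₂, h₂, hne, hF1, hF2, hm, hmH⟩⟩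
  · refine ⟨F.centroid ℝ id, centroid_mem_openSimplex hFn, fun m' => ⟨?_, ?_⟩⟩
    · rintro ⟨-, -, ⟨T₁', h₁', T₂', h₂', hne', hF1', hF2', -, -⟩ | ⟨-, h⟩⟩
      · exact absurd ⟨T₁', h₁', T₂', h₂', hne', hF1', hF2'⟩ hS
      · exact h
    · rintro rfl
      exact ⟨hF, h3, Or.inr ⟨convexHull_subset_frontier h𝒯 hF h3 hS, rfl⟩⟩

/-- The split point of the face `F` (zero if `F` has none). -/
noncomputable def splitPoint (𝒯 : Geometry.SimplicialComplex ℝ Point) (Ω : Set Point)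
    (F : Finset Point) : Point :=
  if h : ∃ m, IsSplitPoint 𝒯 Ω F m then h.choose else 0

theorem isSplitPoint_iff (h𝒯 : IsTriangulation 𝒯 Ω) {F : Finset Point}
    (hF : F ∈ 𝒯.faces) (h3 : F.card = 3) {m : Point} :
    IsSplitPoint 𝒯 Ω F m ↔ m = splitPoint 𝒯 Ω F := by
  obtain ⟨m₀, -, h⟩ := exists_isSplitPoint_iff h𝒯 hF h3
  have hex : ∃ m, IsSplitPoint 𝒯 Ω F m := ⟨m₀, (h m₀).2 rfl⟩
  rw [splitPoint, dif_pos hex, h, (h _).1 hex.choose_spec]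

theorem splitPoint_mem_openSimplex (h𝒯 : IsTriangulation 𝒯 Ω) {F : Finset Point}
    (hF : F ∈ 𝒯.faces) (h3 : F.card = 3) : splitPoint 𝒯 Ω F ∈ openSimplex F := by
  obtain ⟨m₀, hm₀, h⟩ := exists_isSplitPoint_iff h𝒯 hF h3
  rwa [(h _).1 ((isSplitPoint_iff h𝒯 hF h3).2 rfl)]

theorem splitPoint_mem_segment (h𝒯 : IsTriangulation 𝒯 Ω) {T₁ T₂ F : Finset Point}
    (h₁ : T₁ ∈ tetrahedra 𝒯) (h₂ : T₂ ∈ tetrahedra 𝒯) (hne : T₁ ≠ T₂) (hF : F ∈ 𝒯.faces)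
    (h3 : F.card = 3) (hF1 : F ⊆ T₁) (hF2 : F ⊆ T₂) :
    splitPoint 𝒯 Ω F ∈ segment ℝ (incenter T₁) (incenter T₂) := by
  obtain ⟨m, hm, hmF⟩ := exists_mem_segment_incenter h₁ h₂ hne h3 hF1 hF2
  have hmS : IsSplitPoint 𝒯 Ω F m :=
    ⟨hF, h3, Or.inl ⟨T₁, h₁, T₂, h₂, hne, hF1, hF2, hm, openSimplex_subset_convexHull F hmF⟩⟩
  rwa [← (isSplitPoint_iff h𝒯 hF h3).1 hmS]

/-- The triangular faces of the complex. -/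
def triangles (𝒯 : Geometry.SimplicialComplex ℝ Point) : Set (Finset Point) :=
  {F | F ∈ 𝒯.faces ∧ F.card = 3}

theorem splitPoint_injOn (h𝒯 : IsTriangulation 𝒯 Ω) :
    Set.InjOn (splitPoint 𝒯 Ω) (triangles 𝒯) := fun _ hF _ hF' h =>
  eq_of_mem_openSimplex hF.1 hF'.1 (splitPoint_mem_openSimplex h𝒯 hF.1 hF.2)
    (h ▸ splitPoint_mem_openSimplex h𝒯 hF'.1 hF'.2)

theorem interiorSplitPoints_eq (h𝒯 : IsTriangulation 𝒯 Ω) :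
    interiorSplitPoints 𝒯 Ω = splitPoint 𝒯 Ω '' {F | F ∈ triangles 𝒯 ∧ IsShared 𝒯 F} := by
  ext m
  constructor
  · rintro ⟨⟨F, hFm⟩, hm⟩
    have hF := hFm.1
    have h3 := hFm.2.1
    rw [isSplitPoint_iff h𝒯 hF h3] at hFm
    refine ⟨F, ⟨⟨hF, h3⟩, ?_⟩, hFm.symm⟩
    by_contra hS
    have := convexHull_subset_frontier h𝒯 hF h3 hS
      (openSimplex_subset_convexHull F (splitPoint_mem_openSimplex h𝒯 hF h3))
    rw [(isTriangulation_isOpen h𝒯).frontier_eq, ← hFm] at this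
    exact this.2 hm
  · rintro ⟨F, ⟨⟨hF, h3⟩, hS⟩, rfl⟩
    refine ⟨⟨F, (isSplitPoint_iff h𝒯 hF h3).2 rfl⟩, ?_⟩
    exact h𝒯.interior_space.subset
      (openSimplex_subset_interior_space h3 hS (splitPoint_mem_openSimplex h𝒯 hF h3))

theorem boundarySplitPoints_eq (h𝒯 : IsTriangulation 𝒯 Ω) :
    boundarySplitPoints 𝒯 Ω = splitPoint 𝒯 Ω '' {F | F ∈ triangles 𝒯 ∧ ¬ IsShared 𝒯 F} := by
  ext m
  constructor
  · rintro ⟨⟨F, hFm⟩, hm⟩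
    have hF := hFm.1
    have h3 := hFm.2.1
    rw [isSplitPoint_iff h𝒯 hF h3] at hFm
    refine ⟨F, ⟨⟨hF, h3⟩, fun hS => ?_⟩, hFm.symm⟩
    exact notMem_frontier_of_isShared h𝒯 h3 hS (splitPoint_mem_openSimplex h𝒯 hF h3) (hFm ▸ hm)
  · rintro ⟨F, ⟨⟨hF, h3⟩, hS⟩, rfl⟩
    exact ⟨⟨F, (isSplitPoint_iff h𝒯 hF h3).2 rfl⟩, convexHull_subset_frontier h𝒯 hF h3 hS
      (openSimplex_subset_convexHull F (splitPoint_mem_openSimplex h𝒯 hF h3))⟩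

/-! ### The tetrahedra of the refinement -/

/-- The tetrahedron of the refinement spanned by the incenter of `T`, the split point of the face
`F` of `T`, and the edge of `F` opposite to the vertex `v` of `F`. -/
noncomputable def cell (𝒯 : Geometry.SimplicialComplex ℝ Point) (Ω : Set Point)
    (T F : Finset Point) (v : Point) : Finset Point :=
  insert (incenter T) (insert (splitPoint 𝒯 Ω F) (F.erase v))

/-- `F` is a triangular face of the tetrahedron `T` of `𝒯`, and `v` is a vertex of `F`. -/
structure IsFlag (𝒯 : Geometry.SimplicialComplex ℝ Point) (T F : Finset Point) (v : Point) :
    Prop where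
  mem : T ∈ tetrahedra 𝒯
  subset : F ⊆ T
  card : F.card = 3
  vertex : v ∈ F

theorem IsFlag.triangle {T F : Finset Point} {v : Point} (h : IsFlag 𝒯 T F v) :
    F ∈ triangles 𝒯 :=
  ⟨𝒯.down_closed h.mem.1 h.subset ⟨v, h.vertex⟩, h.card⟩

theorem mem_refinement_iff (h𝒯 : IsTriangulation 𝒯 Ω) {K : Finset Point} :
    K ∈ refinement 𝒯 Ω ↔ ∃ T F v, IsFlag 𝒯 T F v ∧ K = cell 𝒯 Ω T F v := by
  constructor
  · rintro ⟨T, hT, F, hFT, h3, m, hm, e, heF, h2, hK⟩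
    have hmS := (isSplitPoint_iff h𝒯 hm.1 h3).1 hm
    obtain ⟨v, hv, hve⟩ := (Finset.exists_eq_insert_iff (s := e) (t := F)).2 ⟨heF, by omega⟩
    refine ⟨T, F, v, ⟨hT, hFT, h3, hve ▸ Finset.mem_insert_self v e⟩, ?_⟩
    apply Finset.coe_injective
    rw [hK, cell, ← hve, Finset.erase_insert hv, hve, hmS]
    simp
  · rintro ⟨T, F, v, h, rfl⟩
    refine ⟨T, h.mem, F, h.subset, h.card, splitPoint 𝒯 Ω F,
      (isSplitPoint_iff h𝒯 h.triangle.1 h.card).2 rfl, F.erase v, F.erase_subset v, ?_, ?_⟩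
    · rw [Finset.card_erase_of_mem h.vertex, h.card]
    · simp [cell]

theorem cell_mem_refinement (h𝒯 : IsTriangulation 𝒯 Ω) {T F : Finset Point} {v : Point}
    (h : IsFlag 𝒯 T F v) : cell 𝒯 Ω T F v ∈ refinement 𝒯 Ω :=
  (mem_refinement_iff h𝒯).2 ⟨T, F, v, h, rfl⟩

theorem incenter_mem {T : Finset Point} (hT : T ∈ tetrahedra 𝒯) : incenter T ∈ openSimplex T :=
  incenter_mem_openSimplex (𝒯.indep hT.1) hT.2

theorem singleton_mem_faces {s : Finset Point} (hs : s ∈ 𝒯.faces) {v : Point} (hv : v ∈ s) :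
    {v} ∈ 𝒯.faces :=
  𝒯.down_closed hs (Finset.singleton_subset_iff.2 hv) (Finset.singleton_nonempty v)

theorem incenter_injOn : Set.InjOn incenter (tetrahedra 𝒯) := fun _ hT _ hT' h =>
  eq_of_mem_openSimplex hT.1 hT'.1 (incenter_mem hT) (h ▸ incenter_mem hT')

theorem incenter_ne_splitPoint (h𝒯 : IsTriangulation 𝒯 Ω) {T F : Finset Point}
    (hT : T ∈ tetrahedra 𝒯) (hF : F ∈ triangles 𝒯) : incenter T ≠ splitPoint 𝒯 Ω F := fun h => by
  have h1 := eq_of_mem_openSimplex hT.1 hF.1 (incenter_mem hT)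
    (h ▸ splitPoint_mem_openSimplex h𝒯 hF.1 hF.2)
  have := hT.2
  rw [h1, hF.2] at this
  omega

theorem incenter_ne_vertex {T s : Finset Point} (hT : T ∈ tetrahedra 𝒯)
    (hs : s ∈ 𝒯.faces) {v : Point} (hv : v ∈ s) : incenter T ≠ v := fun h => by
  have h1 := eq_of_mem_openSimplex hT.1 (singleton_mem_faces hs hv) (incenter_mem hT)
    (h ▸ mem_openSimplex_singleton v)
  have := hT.2
  rw [h1, Finset.card_singleton] at this
  omega

theorem splitPoint_ne_vertex (h𝒯 : IsTriangulation 𝒯 Ω) {F s : Finset Point}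
    (hF : F ∈ triangles 𝒯) (hs : s ∈ 𝒯.faces) {v : Point} (hv : v ∈ s) :
    splitPoint 𝒯 Ω F ≠ v := fun h => by
  have h1 := eq_of_mem_openSimplex hF.1 (singleton_mem_faces hs hv)
    (splitPoint_mem_openSimplex h𝒯 hF.1 hF.2) (h ▸ mem_openSimplex_singleton v)
  have := hF.2
  rw [h1, Finset.card_singleton] at this
  omega

theorem mem_cell {T F : Finset Point} {v x : Point} :
    x ∈ cell 𝒯 Ω T F v ↔ x = incenter T ∨ x = splitPoint 𝒯 Ω F ∨ (x ≠ v ∧ x ∈ F) := by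
  simp [cell]

theorem incenter_mem_cell_iff (h𝒯 : IsTriangulation 𝒯 Ω) {T T' F : Finset Point} {v : Point}
    (h : IsFlag 𝒯 T F v) (hT' : T' ∈ tetrahedra 𝒯) :
    incenter T' ∈ cell 𝒯 Ω T F v ↔ T' = T := by
  rw [mem_cell]
  refine ⟨?_, fun h => Or.inl (h ▸ rfl)⟩
  rintro (h1 | h1 | ⟨-, h1⟩)
  · exact incenter_injOn hT' h.mem h1
  · exact absurd h1 (incenter_ne_splitPoint h𝒯 hT' h.triangle)
  · exact absurd rfl (incenter_ne_vertex hT' h.triangle.1 h1)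

theorem splitPoint_mem_cell_iff (h𝒯 : IsTriangulation 𝒯 Ω) {T F F' : Finset Point} {v : Point}
    (h : IsFlag 𝒯 T F v) (hF' : F' ∈ triangles 𝒯) :
    splitPoint 𝒯 Ω F' ∈ cell 𝒯 Ω T F v ↔ F' = F := by
  rw [mem_cell]
  refine ⟨?_, fun h => Or.inr (Or.inl (h ▸ rfl))⟩
  rintro (h1 | h1 | ⟨-, h1⟩)
  · exact absurd h1.symm (incenter_ne_splitPoint h𝒯 h.mem hF')
  · exact splitPoint_injOn h𝒯 hF' h.triangle h1
  · exact absurd rfl (splitPoint_ne_vertex h𝒯 hF' h.triangle.1 h1)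

theorem vertex_mem_cell_iff (h𝒯 : IsTriangulation 𝒯 Ω) {T F s : Finset Point} {v u : Point}
    (h : IsFlag 𝒯 T F v) (hs : s ∈ 𝒯.faces) (hu : u ∈ s) :
    u ∈ cell 𝒯 Ω T F v ↔ u ≠ v ∧ u ∈ F := by
  rw [mem_cell]
  refine ⟨?_, fun h => Or.inr (Or.inr h)⟩
  rintro (h1 | h1 | h1)
  · exact absurd h1.symm (incenter_ne_vertex h.mem hs hu)
  · exact absurd h1.symm (splitPoint_ne_vertex h𝒯 h.triangle hs hu)
  · exact h1

theorem cell_injective (h𝒯 : IsTriangulation 𝒯 Ω) {T F T' F' : Finset Point} {v v' : Point}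
    (h : IsFlag 𝒯 T F v) (h' : IsFlag 𝒯 T' F' v') (he : cell 𝒯 Ω T F v = cell 𝒯 Ω T' F' v') :
    T = T' ∧ F = F' ∧ v = v' := by
  have h1 := (incenter_mem_cell_iff h𝒯 h' h.mem).1 (he ▸ (incenter_mem_cell_iff h𝒯 h h.mem).2 rfl)
  have h2 := (splitPoint_mem_cell_iff h𝒯 h' h.triangle).1
    (he ▸ (splitPoint_mem_cell_iff h𝒯 h h.triangle).2 rfl)
  refine ⟨h1, h2, ?_⟩
  by_contra hne
  have h3 := (vertex_mem_cell_iff h𝒯 h' h.triangle.1 h.vertex).2 ⟨hne, h2 ▸ h.vertex⟩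
  rw [← he, vertex_mem_cell_iff h𝒯 h h.triangle.1 h.vertex] at h3
  exact h3.1 rfl

/-! ### Edges that are not singular -/

/-- If three points `p` of `X` span with the edge `e` three faces, pairwise not coplanar, then `e`
is not singular. -/
theorem notMem_singularEdges {M : Set (Finset Point)} {e X : Finset Point} (hX : X.card = 3)
    (h2 : e.card = 2) (hM : ∀ p ∈ X, ∃ K ∈ M, insert p e ⊆ K)
    (hsep : ∀ p ∈ X, ∀ q ∈ X, p ≠ q →
      ∃ f : Point →ᵃ[ℝ] ℝ, (∀ x ∈ e, f x = 0) ∧ f p = 0 ∧ f q ≠ 0) :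
    e ∉ singularEdges M := by
  rintro ⟨-, hcard⟩
  set P := {P : AffineSubspace ℝ Point |
      ∃ f ∈ subsimplices M 3, e ⊆ f ∧ P = affineSpan ℝ (f : Set Point)}
  have hfin : P.Finite := Set.finite_of_ncard_ne_zero (by omega)
  let φ : Point → AffineSubspace ℝ Point :=
    fun p => affineSpan ℝ ((insert p e : Finset Point) : Set Point)
  have hmaps : ∀ p ∈ X, φ p ∈ P := by
    intro p hp
    obtain ⟨K, hK, hsub⟩ := hM p hp
    refine ⟨insert p e, ⟨?_, K, hK, hsub⟩, Finset.subset_insert _ _, rfl⟩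
    obtain ⟨q, hq, hqp⟩ := Finset.exists_mem_ne (by omega : 1 < X.card) p
    obtain ⟨f, hf, -, hfp⟩ := hsep q hq p hp hqp
    rw [Finset.card_insert_of_notMem fun h => hfp (hf p h), h2]
  have hinj : Set.InjOn φ X := by
    intro p hp q hq hpq
    by_contra hne
    obtain ⟨f, hf, hfp, hfq⟩ := hsep p hp q hq hne
    have hq' : q ∈ affineSpan ℝ ((insert p e : Finset Point) : Set Point) := by
      change q ∈ φ p
      rw [hpq]
      exact subset_affineSpan ℝ _ (by simp)
    have hle : affineSpan ℝ ((insert p e : Finset Point) : Set Point) ≤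
        (affineSpan ℝ {(0 : ℝ)}).comap f := by
      rw [affineSpan_le]
      intro x hx
      rw [Finset.mem_coe, Finset.mem_insert] at hx
      have : f x = 0 := by
        obtain rfl | hx := hx
        exacts [hfp, hf x hx]
      simp [this]
    have := hle hq'
    rw [AffineSubspace.mem_comap, AffineSubspace.mem_affineSpan_singleton] at this
    exact hfq this
  have h3 : (φ '' (X : Set Point)).ncard = 3 := by
    rw [hinj.ncard_image, Set.ncard_coe_finset, hX]
  have hsub : φ '' (X : Set Point) ⊆ P := by
    rintro _ ⟨p, hp, rfl⟩
    exact hmaps p hp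
  have := Set.ncard_le_ncard hsub hfin
  omega

theorem exists_third {F : Finset Point} (h3 : F.card = 3) {p q : Point} (hp : p ∈ F) (hq : q ∈ F)
    (hpq : p ≠ q) : ∃ r ∈ F, r ≠ p ∧ r ≠ q ∧ F = {p, q, r} := by
  have h1 : ((F.erase p).erase q).card = 1 := by
    rw [Finset.card_erase_of_mem (Finset.mem_erase.2 ⟨hpq.symm, hq⟩), Finset.card_erase_of_mem hp,
      h3]
  obtain ⟨r, hr⟩ := Finset.card_eq_one.1 h1
  have hr' : r ∈ (F.erase p).erase q := by simp [hr]
  simp only [Finset.mem_erase] at hr'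
  refine ⟨r, hr'.2.2, hr'.2.1, hr'.1, ?_⟩
  rw [← hr, Finset.insert_erase (Finset.mem_erase.2 ⟨hpq.symm, hq⟩), Finset.insert_erase hp]

/-- The edge from an incenter to the split point of a face is not singular: the three vertices of
the face give three planes. -/
theorem incenter_splitPoint_notMem_singularEdges (h𝒯 : IsTriangulation 𝒯 Ω) {T F : Finset Point}
    (hT : T ∈ tetrahedra 𝒯) (hFT : F ⊆ T) (hF : F ∈ triangles 𝒯) :
    {incenter T, splitPoint 𝒯 Ω F} ∉ singularEdges (refinement 𝒯 Ω) := by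
  refine notMem_singularEdges (X := F) hF.2
    (Finset.card_pair (incenter_ne_splitPoint h𝒯 hT hF)) (fun p hp => ?_) fun p hp q hq hpq => ?_
  · obtain ⟨v, hv, hvp⟩ := Finset.exists_mem_ne (by rw [hF.2]; omega : 1 < F.card) p
    refine ⟨_, cell_mem_refinement h𝒯 ⟨hT, hFT, hF.2, hv⟩, ?_⟩
    intro x hx
    simp only [Finset.mem_insert, Finset.mem_singleton] at hx
    rw [mem_cell]
    obtain rfl | rfl | rfl := hx
    · exact Or.inr (Or.inr ⟨hvp.symm, hp⟩)
    · exact Or.inl rfl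
    · exact Or.inr (Or.inl rfl)
  · obtain ⟨l, hl⟩ := exists_isCoord (𝒯.indep hT.1) hT.2
    obtain ⟨w, hw, hwF⟩ := exists_insert_eq hT.2 hF.2 hFT
    have hwT : w ∈ T := hwF ▸ Finset.mem_insert_self w F
    obtain ⟨r, hr, hrp, hrq, -⟩ := exists_third hF.2 hp hq hpq
    have hm := splitPoint_mem_openSimplex h𝒯 hF.1 hF.2
    have hmr := hl.pos_of_mem_openSimplex hFT hm hr
    have hmw := hl.eq_zero_of_mem_openSimplex hFT hm hwT hw
    have hcw := hl.pos_of_mem_openSimplex subset_rfl (incenter_mem hT) hwT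
    set m := splitPoint 𝒯 Ω F
    set c := incenter T
    -- The coefficients are the solution of the conditions that the function vanish at `m` and `c`.
    refine ⟨l r m • l q - l q m • l r - ((l r m * l q c - l q m * l r c) / l w c) • l w,
      ?_, ?_, ?_⟩
    · intro x hx
      simp only [Finset.mem_insert, Finset.mem_singleton] at hx
      obtain rfl | rfl := hx
      · simp only [AffineMap.coe_sub, AffineMap.coe_smul, Pi.sub_apply, Pi.smul_apply, smul_eq_mul]
        field_simp
        ring
      · simp only [AffineMap.coe_sub, AffineMap.coe_smul, Pi.sub_apply, Pi.smul_apply, smul_eq_mul,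
          hmw]
        ring
    · simp only [AffineMap.coe_sub, AffineMap.coe_smul, Pi.sub_apply, Pi.smul_apply, smul_eq_mul]
      rw [hl.ne p (hFT hp) q (hFT hq) hpq, hl.ne p (hFT hp) r (hFT hr) hrp.symm,
        hl.ne p (hFT hp) w hwT (fun h => hw (h ▸ hp))]
      ring
    · simp only [AffineMap.coe_sub, AffineMap.coe_smul, Pi.sub_apply, Pi.smul_apply, smul_eq_mul]
      rw [hl.self q (hFT hq), hl.ne q (hFT hq) r (hFT hr) hrq.symm,
        hl.ne q (hFT hq) w hwT (fun h => hw (h ▸ hq))]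
      simpa using hmr.ne'

/-- The edge from an incenter to a vertex is not singular: the three other vertices of the
tetrahedron give three planes. -/
theorem incenter_vertex_notMem_singularEdges (h𝒯 : IsTriangulation 𝒯 Ω) {T : Finset Point}
    {u : Point} (hT : T ∈ tetrahedra 𝒯) (hu : u ∈ T) :
    {incenter T, u} ∉ singularEdges (refinement 𝒯 Ω) := by
  have hX : (T.erase u).card = 3 := by rw [Finset.card_erase_of_mem hu, hT.2]
  refine notMem_singularEdges (X := T.erase u) hX
    (Finset.card_pair (incenter_ne_vertex hT hT.1 hu)) (fun p hp => ?_) fun p hp q hq hpq => ?_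
  · obtain ⟨q, hq, hqp⟩ := Finset.exists_mem_ne (by rw [hX]; omega : 1 < (T.erase u).card) p
    obtain ⟨r, hr, hrp, hrq, -⟩ := exists_third hX hp hq hqp.symm
    simp only [Finset.mem_erase] at hp hq hr
    have hf : IsFlag 𝒯 T (T.erase q) r :=
      ⟨hT, T.erase_subset q, by rw [Finset.card_erase_of_mem hq.2, hT.2],
        Finset.mem_erase.2 ⟨hrq, hr.2⟩⟩
    refine ⟨_, cell_mem_refinement h𝒯 hf, ?_⟩
    intro x hx
    simp only [Finset.mem_insert, Finset.mem_singleton] at hx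
    rw [mem_cell]
    obtain rfl | rfl | rfl := hx
    · exact Or.inr (Or.inr ⟨hrp.symm, Finset.mem_erase.2 ⟨hqp.symm, hp.2⟩⟩)
    · exact Or.inl rfl
    · exact Or.inr (Or.inr ⟨hr.1.symm, Finset.mem_erase.2 ⟨hq.1.symm, hu⟩⟩)
  · obtain ⟨l, hl⟩ := exists_isCoord (𝒯.indep hT.1) hT.2
    obtain ⟨r, hr, hrp, hrq, -⟩ := exists_third hX hp hq hpq
    simp only [Finset.mem_erase] at hp hq hr
    have hcr := hl.pos_of_mem_openSimplex subset_rfl (incenter_mem hT) hr.2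
    set c := incenter T
    refine ⟨l r c • l q - l q c • l r, ?_, ?_, ?_⟩
    · intro x hx
      simp only [Finset.mem_insert, Finset.mem_singleton] at hx
      obtain rfl | rfl := hx
      · simp only [AffineMap.coe_sub, AffineMap.coe_smul, Pi.sub_apply, Pi.smul_apply, smul_eq_mul]
        ring
      · simp only [AffineMap.coe_sub, AffineMap.coe_smul, Pi.sub_apply, Pi.smul_apply, smul_eq_mul]
        rw [hl.ne x hu q hq.2 hq.1.symm, hl.ne x hu r hr.2 hr.1.symm]
        ring
    · simp only [AffineMap.coe_sub, AffineMap.coe_smul, Pi.sub_apply, Pi.smul_apply, smul_eq_mul]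
      rw [hl.ne p hp.2 q hq.2 hpq, hl.ne p hp.2 r hr.2 hrp.symm]
      ring
    · simp only [AffineMap.coe_sub, AffineMap.coe_smul, Pi.sub_apply, Pi.smul_apply, smul_eq_mul]
      rw [hl.self q hq.2, hl.ne q hq.2 r hr.2 hrq.symm]
      simpa using hcr.ne'

/-- An edge of the original triangulation is not singular: the planes of the two faces of a
tetrahedron that meet there, and the plane through the incenter, are different. -/
theorem edge_notMem_singularEdges (h𝒯 : IsTriangulation 𝒯 Ω) {T F : Finset Point} {v : Point}
    (h : IsFlag 𝒯 T F v) : F.erase v ∉ singularEdges (refinement 𝒯 Ω) := by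
  have ⟨hT, hFT, h3, hv⟩ := h
  have hF := h.triangle
  obtain ⟨w, hw, hwF⟩ := exists_insert_eq hT.2 h3 hFT
  have hwT : w ∈ T := hwF ▸ Finset.mem_insert_self w F
  have hwv : w ≠ v := fun h => hw (h ▸ hv)
  have hf' : IsFlag 𝒯 T (T.erase v) w :=
    ⟨hT, T.erase_subset v, by rw [Finset.card_erase_of_mem (hFT hv), hT.2],
      Finset.mem_erase.2 ⟨hwv, hwT⟩⟩
  have hF' := hf'.triangle
  obtain ⟨l, hl⟩ := exists_isCoord (𝒯.indep hT.1) hT.2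
  have hm := splitPoint_mem_openSimplex h𝒯 hF.1 hF.2
  have hm' := splitPoint_mem_openSimplex h𝒯 hF'.1 hF'.2
  have hmv := hl.pos_of_mem_openSimplex hFT hm hv
  have hmw := hl.eq_zero_of_mem_openSimplex hFT hm hwT hw
  have hmv' := hl.eq_zero_of_mem_openSimplex (T.erase_subset v) hm' (hFT hv)
    (Finset.notMem_erase v T)
  have hmw' := hl.pos_of_mem_openSimplex (T.erase_subset v) hm' hf'.vertex
  have hcv := hl.pos_of_mem_openSimplex subset_rfl (incenter_mem hT) (hFT hv)
  have hcw := hl.pos_of_mem_openSimplex subset_rfl (incenter_mem hT) hwT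
  have hne := incenter_ne_splitPoint h𝒯 hT hF
  have hne' := incenter_ne_splitPoint h𝒯 hT hF'
  have hmm : splitPoint 𝒯 Ω F ≠ splitPoint 𝒯 Ω (T.erase v) := fun h => by
    rw [h, hmv'] at hmv
    exact lt_irrefl _ hmv
  have hK := cell_mem_refinement h𝒯 h
  have hK' := cell_mem_refinement h𝒯 hf'
  have hev (x : Point) (hx : x ∈ F.erase v) : l v x = 0 ∧ l w x = 0 := by
    rw [Finset.mem_erase] at hx
    exact ⟨hl.ne x (hFT hx.2) v (hFT hv) hx.1, hl.ne x (hFT hx.2) w hwT fun h => hw (h ▸ hx.2)⟩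
  have hsub : F.erase v ⊆ cell 𝒯 Ω T F v := fun x hx =>
    mem_cell.2 (Or.inr (Or.inr (Finset.mem_erase.1 hx)))
  have hsub' : F.erase v ⊆ cell 𝒯 Ω T (T.erase v) w := fun x hx =>
    mem_cell.2 (Or.inr (Or.inr ⟨fun h => hw (h ▸ Finset.mem_of_mem_erase hx),
      Finset.erase_subset_erase v hFT hx⟩))
  refine notMem_singularEdges
    (X := {incenter T, splitPoint 𝒯 Ω F, splitPoint 𝒯 Ω (T.erase v)})
    (Finset.card_eq_three.2 ⟨_, _, _, hne, hne', hmm, rfl⟩)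
    (by rw [Finset.card_erase_of_mem hv, h3]) (fun p hp => ?_) fun p hp q hq hpq => ?_
  · simp only [Finset.mem_insert, Finset.mem_singleton] at hp
    obtain rfl | rfl | rfl := hp
    · exact ⟨_, hK, Finset.insert_subset (mem_cell.2 (Or.inl rfl)) hsub⟩
    · exact ⟨_, hK, Finset.insert_subset (mem_cell.2 (Or.inr (Or.inl rfl))) hsub⟩
    · exact ⟨_, hK', Finset.insert_subset (mem_cell.2 (Or.inr (Or.inl rfl))) hsub'⟩
  · simp only [Finset.mem_insert, Finset.mem_singleton] at hp hq
    obtain rfl | rfl | rfl := hp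
    · refine ⟨l w (incenter T) • l v - l v (incenter T) • l w, fun x hx => ?_, ?_, ?_⟩
      · simp [hev x hx]
      · simp only [AffineMap.coe_sub, AffineMap.coe_smul, Pi.sub_apply, Pi.smul_apply, smul_eq_mul]
        ring
      · obtain rfl | rfl | rfl := hq
        · exact absurd rfl hpq
        · simp [hmw, hmv.ne', hcw.ne']
        · simp [hmv', hmw'.ne', hcv.ne']
    · refine ⟨l w, fun x hx => (hev x hx).2, hmw, ?_⟩
      obtain rfl | rfl | rfl := hq
      · exact hcw.ne'
      · exact absurd rfl hpq
      · exact hmw'.ne'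
    · refine ⟨l v, fun x hx => (hev x hx).1, hmv', ?_⟩
      obtain rfl | rfl | rfl := hq
      · exact hcv.ne'
      · exact hmv.ne'
      · exact absurd rfl hpq

/-! ### The singular edges -/

/-- A point of the open triangle and two vertices of the triangle span its plane. -/
theorem affineSpan_splitPoint_eq {F : Finset Point} {m : Point} (h3 : F.card = 3)
    (hm : m ∈ openSimplex F) {u x : Point} (hu : u ∈ F) (hx : x ∈ F) (hux : u ≠ x) :
    affineSpan ℝ (({m, u, x} : Finset Point) : Set Point) = affineSpan ℝ (F : Set Point) := by
  apply le_antisymm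
  · rw [affineSpan_le]
    intro y hy
    simp only [Finset.coe_insert, Finset.coe_singleton, Set.mem_insert_iff,
      Set.mem_singleton_iff] at hy
    obtain rfl | rfl | rfl := hy
    · exact convexHull_subset_affineSpan _ (openSimplex_subset_convexHull F hm)
    · exact subset_affineSpan ℝ _ hu
    · exact subset_affineSpan ℝ _ hx
  · obtain ⟨y, hy, hyu, hyx, hF⟩ := exists_third h3 hu hx hux
    obtain ⟨w, hw, h1, hwm⟩ := hm
    have hmS : m ∈ affineSpan ℝ (({m, u, x} : Finset Point) : Set Point) :=
      subset_affineSpan ℝ _ (by simp)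
    have huS : u ∈ affineSpan ℝ (({m, u, x} : Finset Point) : Set Point) :=
      subset_affineSpan ℝ _ (by simp)
    have hxS : x ∈ affineSpan ℝ (({m, u, x} : Finset Point) : Set Point) :=
      subset_affineSpan ℝ _ (by simp)
    have hyS : y ∈ affineSpan ℝ (({m, u, x} : Finset Point) : Set Point) := by
      have hwy := (hw y hy).ne'
      rw [hF, Finset.sum_insert (by simp [hux, hyu.symm]), Finset.sum_pair hyx.symm] at h1 hwm
      have e : y = (w u / w y) • (m -ᵥ u) +ᵥ ((w x / w y) • (m -ᵥ x) +ᵥ m) := by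
        have e1 : w y • y = w y • ((w u / w y) • (m -ᵥ u) +ᵥ ((w x / w y) • (m -ᵥ x) +ᵥ m)) := by
          simp only [vsub_eq_sub, vadd_eq_add, smul_add, smul_smul, mul_div_cancel₀ _ hwy]
          have e2 : w y = 1 - w u - w x := by linarith
          have e3 : w y • y = m - w u • u - w x • x := by rw [← hwm]; abel
          rw [e3, e2]
          module
        exact smul_right_injective Point hwy e1
      rw [e]
      exact AffineSubspace.smul_vsub_vadd_mem _ _ hmS huS
        (AffineSubspace.smul_vsub_vadd_mem _ _ hmS hxS hmS)
    rw [affineSpan_le]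
    intro z hz
    rw [hF] at hz
    simp only [Finset.coe_insert, Finset.coe_singleton, Set.mem_insert_iff,
      Set.mem_singleton_iff] at hz
    obtain rfl | rfl | rfl := hz
    exacts [huS, hxS, hyS]

/-- Since the split point of a face lies on the line through the incenters of the tetrahedra `T` and
`T'` at that face, both incenters span with it and `u` the same plane. -/
theorem affineSpan_incenter_le (h𝒯 : IsTriangulation 𝒯 Ω) {T T' F : Finset Point}
    (hT : T ∈ tetrahedra 𝒯) (hT' : T' ∈ tetrahedra 𝒯) (hF : F ∈ triangles 𝒯) (hFT : F ⊆ T)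
    (hFT' : F ⊆ T') (u : Point) :
    affineSpan ℝ (({splitPoint 𝒯 Ω F, u, incenter T'} : Finset Point) : Set Point) ≤
      affineSpan ℝ (({splitPoint 𝒯 Ω F, u, incenter T} : Finset Point) : Set Point) := by
  by_cases hne : T = T'
  · rw [hne]
  have hm := splitPoint_mem_segment h𝒯 hT hT' hne hF.1 hF.2 hFT hFT'
  have hc := incenter_ne_splitPoint h𝒯 hT hF
  set m := splitPoint 𝒯 Ω F
  rw [segment_eq_image_lineMap] at hm
  obtain ⟨θ, -, hθ⟩ := hm
  have hθ0 : θ ≠ 0 := by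
    rintro rfl
    rw [AffineMap.lineMap_apply_zero] at hθ
    exact hc hθ
  have e : incenter T' = AffineMap.lineMap (incenter T) m θ⁻¹ := by
    rw [AffineMap.lineMap_apply_module] at hθ
    rw [AffineMap.lineMap_apply_module, ← hθ, smul_add, smul_smul, smul_smul,
      inv_mul_cancel₀ hθ0, one_smul, ← add_assoc, ← add_smul]
    have : 1 - θ⁻¹ + θ⁻¹ * (1 - θ) = 0 := by field_simp; ring
    rw [this, zero_smul, zero_add]
  rw [affineSpan_le]
  intro y hy
  simp only [Finset.coe_insert, Finset.coe_singleton, Set.mem_insert_iff,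
    Set.mem_singleton_iff] at hy
  obtain rfl | rfl | rfl := hy
  · exact subset_affineSpan ℝ _ (by simp)
  · exact subset_affineSpan ℝ _ (by simp)
  · rw [e]
    exact AffineMap.lineMap_mem _ (subset_affineSpan ℝ _ (by simp))
      (subset_affineSpan ℝ _ (by simp))

theorem pair_subset_cell_iff (h𝒯 : IsTriangulation 𝒯 Ω) {T F F' : Finset Point} {v u : Point}
    (h : IsFlag 𝒯 T F v) (hF' : F' ∈ triangles 𝒯) (hu : u ∈ F') :
    {splitPoint 𝒯 Ω F', u} ⊆ cell 𝒯 Ω T F v ↔ F' = F ∧ u ≠ v := by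
  rw [Finset.insert_subset_iff, Finset.singleton_subset_iff, splitPoint_mem_cell_iff h𝒯 h hF',
    vertex_mem_cell_iff h𝒯 h hF'.1 hu]
  constructor
  · rintro ⟨h1, h2, -⟩
    exact ⟨h1, h2⟩
  · rintro ⟨rfl, h2⟩
    exact ⟨rfl, h2, hu⟩

/-- The edge joining the split point of a face to a vertex of the face is singular: all faces that
meet there lie in the plane of the face or in the plane through the incenters of the adjacent
tetrahedra. -/
theorem splitPoint_vertex_mem_singularEdges (h𝒯 : IsTriangulation 𝒯 Ω) {F : Finset Point}
    {u : Point} (hF : F ∈ triangles 𝒯) (hu : u ∈ F) :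
    {splitPoint 𝒯 Ω F, u} ∈ singularEdges (refinement 𝒯 Ω) := by
  obtain ⟨T, hT, hFT⟩ := h𝒯.pure F hF.1
  have hmu := splitPoint_ne_vertex h𝒯 hF hF.1 hu
  obtain ⟨v, hv, hvu⟩ := Finset.exists_mem_ne (by rw [hF.2]; omega : 1 < F.card) u
  obtain ⟨w, hw, hwu, hwv, hFe⟩ := exists_third hF.2 hu hv hvu.symm
  have hfl : IsFlag 𝒯 T F v := ⟨hT, hFT, hF.2, hv⟩
  have hcm := incenter_ne_splitPoint h𝒯 hT hF
  have hcu := incenter_ne_vertex hT hF.1 hu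
  have hmw := splitPoint_ne_vertex h𝒯 hF hF.1 hw
  have hmO := splitPoint_mem_openSimplex h𝒯 hF.1 hF.2
  refine ⟨⟨Finset.card_pair hmu, _, cell_mem_refinement h𝒯 hfl,
    (pair_subset_cell_iff h𝒯 hfl hF hu).2 ⟨rfl, hvu.symm⟩⟩, ?_⟩
  refine Set.ncard_eq_two.2 ⟨affineSpan ℝ (F : Set Point),
    affineSpan ℝ (({splitPoint 𝒯 Ω F, u, incenter T} : Finset Point) : Set Point), ?_, ?_⟩
  · intro h
    obtain ⟨l, hl⟩ := exists_isCoord (𝒯.indep hT.1) hT.2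
    obtain ⟨z, hz, hzF⟩ := exists_insert_eq hT.2 hF.2 hFT
    have hzT : z ∈ T := hzF ▸ Finset.mem_insert_self z F
    have hcz := hl.pos_of_mem_openSimplex subset_rfl (incenter_mem hT) hzT
    have hle : affineSpan ℝ (F : Set Point) ≤ (affineSpan ℝ {(0 : ℝ)}).comap (l z) := by
      rw [affineSpan_le]
      intro x hx
      have hx' : x ∈ F := hx
      simp [hl.ne x (hFT hx') z hzT fun h => hz (h ▸ hx')]
    have hc : incenter T ∈ affineSpan ℝ (F : Set Point) := by
      rw [h]
      exact subset_affineSpan ℝ _ (by simp)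
    have := hle hc
    rw [AffineSubspace.mem_comap, AffineSubspace.mem_affineSpan_singleton] at this
    exact hcz.ne' this
  · ext P
    simp only [Set.mem_ofPred_eq, Set.mem_insert_iff, Set.mem_singleton_iff]
    constructor
    · rintro ⟨f, ⟨hf3, K, hK, hfK⟩, hef, rfl⟩
      obtain ⟨T', F', v', hfl', rfl⟩ := (mem_refinement_iff h𝒯).1 hK
      obtain ⟨rfl, huv'⟩ := (pair_subset_cell_iff h𝒯 hfl' hF hu).1 (hef.trans hfK)
      have hmf : splitPoint 𝒯 Ω F ∈ f := hef (by simp)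
      have huf : u ∈ f := hef (by simp)
      obtain ⟨x, hx, hxm, hxu, hfe⟩ := exists_third hf3 hmf huf hmu
      rcases mem_cell.1 (hfK hx) with rfl | h | ⟨-, h⟩
      · right
        rw [hfe]
        exact (affineSpan_incenter_le h𝒯 hT hfl'.mem hF hFT hfl'.subset u).antisymm
          (affineSpan_incenter_le h𝒯 hfl'.mem hT hF hfl'.subset hFT u)
      · exact absurd h hxm
      · left
        rw [hfe]
        exact affineSpan_splitPoint_eq hF.2 hmO hu h hxu.symm
    · rintro (rfl | rfl)
      · refine ⟨{splitPoint 𝒯 Ω F, u, w}, ⟨Finset.card_eq_three.2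
          ⟨_, _, _, hmu, hmw, hwu.symm, rfl⟩, _, cell_mem_refinement h𝒯 hfl, ?_⟩, ?_,
          (affineSpan_splitPoint_eq hF.2 hmO hu hw hwu.symm).symm⟩
        · intro x hx
          simp only [Finset.mem_insert, Finset.mem_singleton] at hx
          rw [mem_cell]
          obtain rfl | rfl | rfl := hx
          exacts [Or.inr (Or.inl rfl), Or.inr (Or.inr ⟨hvu.symm, hu⟩), Or.inr (Or.inr ⟨hwv, hw⟩)]
        · intro x hx
          simp only [Finset.mem_insert, Finset.mem_singleton] at hx ⊢
          tauto
      · refine ⟨{splitPoint 𝒯 Ω F, u, incenter T}, ⟨Finset.card_eq_three.2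
          ⟨_, _, _, hmu, hcm.symm, hcu.symm, rfl⟩, _, cell_mem_refinement h𝒯 hfl, ?_⟩, ?_, rfl⟩
        · intro x hx
          simp only [Finset.mem_insert, Finset.mem_singleton] at hx
          rw [mem_cell]
          obtain rfl | rfl | rfl := hx
          exacts [Or.inr (Or.inl rfl), Or.inr (Or.inr ⟨hvu.symm, hu⟩), Or.inl rfl]
        · intro x hx
          simp only [Finset.mem_insert, Finset.mem_singleton] at hx ⊢
          tauto

theorem mem_singularEdges_iff (h𝒯 : IsTriangulation 𝒯 Ω) {e : Finset Point} :
    e ∈ singularEdges (refinement 𝒯 Ω) ↔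
      ∃ F ∈ triangles 𝒯, ∃ u ∈ F, e = {splitPoint 𝒯 Ω F, u} := by
  refine ⟨fun he => ?_, ?_⟩
  · obtain ⟨h2, K, hK, heK⟩ := he.1
    obtain ⟨T, F, v, h, rfl⟩ := (mem_refinement_iff h𝒯).1 hK
    obtain ⟨x, y, hxy, rfl⟩ := Finset.card_eq_two.1 h2
    have hcv (u : Point) (hu : u ∈ F) : {incenter T, u} ∉ singularEdges (refinement 𝒯 Ω) :=
      incenter_vertex_notMem_singularEdges h𝒯 h.mem (h.subset hu)
    have hcm := incenter_splitPoint_notMem_singularEdges h𝒯 h.mem h.subset h.triangle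
    rcases mem_cell.1 (heK (Finset.mem_insert_self x {y})) with rfl | rfl | ⟨hxv, hx⟩
    · rcases mem_cell.1 (heK (by simp : y ∈ _)) with rfl | rfl | ⟨hyv, hy⟩
      · exact absurd rfl hxy
      · exact absurd he hcm
      · exact absurd he (hcv y hy)
    · rcases mem_cell.1 (heK (by simp : y ∈ _)) with rfl | rfl | ⟨hyv, hy⟩
      · rw [Finset.pair_comm] at he
        exact absurd he hcm
      · exact absurd rfl hxy
      · exact ⟨F, h.triangle, y, hy, rfl⟩
    · rcases mem_cell.1 (heK (by simp : y ∈ _)) with rfl | rfl | ⟨hyv, hy⟩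
      · rw [Finset.pair_comm] at he
        exact absurd he (hcv x hx)
      · exact ⟨F, h.triangle, x, hx, Finset.pair_comm _ _⟩
      · have hE : ({x, y} : Finset Point) = F.erase v := by
          refine Finset.eq_of_subset_of_card_le ?_ ?_
          · intro z hz
            simp only [Finset.mem_insert, Finset.mem_singleton] at hz
            rw [Finset.mem_erase]
            obtain rfl | rfl := hz
            exacts [⟨hxv, hx⟩, ⟨hyv, hy⟩]
          · rw [h2, Finset.card_erase_of_mem h.vertex, h.card]
        rw [hE] at he
        exact absurd he (edge_notMem_singularEdges h𝒯 h)
  · rintro ⟨F, hF, u, hu, rfl⟩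
    exact splitPoint_vertex_mem_singularEdges h𝒯 hF hu

theorem convexHull_pair_subset_frontier_iff (h𝒯 : IsTriangulation 𝒯 Ω) {F : Finset Point}
    {u : Point} (hF : F ∈ triangles 𝒯) (hu : u ∈ F) :
    convexHull ℝ (({splitPoint 𝒯 Ω F, u} : Finset Point) : Set Point) ⊆ frontier Ω ↔
      ¬ IsShared 𝒯 F := by
  have hm := splitPoint_mem_openSimplex h𝒯 hF.1 hF.2
  constructor
  · intro h hS
    exact notMem_frontier_of_isShared h𝒯 hF.2 hS hm (h (subset_convexHull ℝ _ (by simp)))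
  · intro hS
    refine (convexHull_min ?_ (convex_convexHull ℝ _)).trans
      (convexHull_subset_frontier h𝒯 hF.1 hF.2 hS)
    intro x hx
    simp only [Finset.coe_insert, Finset.coe_singleton, Set.mem_insert_iff,
      Set.mem_singleton_iff] at hx
    obtain rfl | rfl := hx
    · exact openSimplex_subset_convexHull F hm
    · exact subset_convexHull ℝ _ hu

/-! ### The conditions on the pressure space -/

/-- The extension by zero to all finite sets of a function on a set of finite sets. -/
noncomputable def extendZero {M : Set (Finset Point)} (q : M → ℝ) (K : Finset Point) : ℝ :=
  if h : K ∈ M then q ⟨K, h⟩ else 0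

theorem extendZero_coe {M : Set (Finset Point)} (q : M → ℝ) (K : M) : extendZero q K = q K := by
  simp [extendZero]

theorem extendZero_of_mem {M : Set (Finset Point)} (q : M → ℝ) {K : Finset Point} (h : K ∈ M) :
    extendZero q K = q ⟨K, h⟩ := by
  simp [extendZero, h]

/-- Two tetrahedra of the refinement over the same face that share a common face lie in the same
tetrahedron of the original triangulation, or over the same edge. -/
theorem eq_or_eq_of_common_face (h𝒯 : IsTriangulation 𝒯 Ω) {T T' F : Finset Point} {v v' : Point}
    (h : IsFlag 𝒯 T F v) (h' : IsFlag 𝒯 T' F v') {f : Finset Point} (h3 : f.card = 3)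
    (hf : f ⊆ cell 𝒯 Ω T F v) (hf' : f ⊆ cell 𝒯 Ω T' F v') : T = T' ∨ v = v' := by
  by_contra! hne
  have hsub : f ⊆ insert (splitPoint 𝒯 Ω F) ((F.erase v).erase v') := by
    intro x hx
    rcases mem_cell.1 (hf hx) with rfl | rfl | ⟨hxv, hxF⟩
    · exact absurd ((incenter_mem_cell_iff h𝒯 h' h.mem).1 (hf' hx)) hne.1
    · exact Finset.mem_insert_self _ _
    · have := (vertex_mem_cell_iff h𝒯 h' h.triangle.1 hxF).1 (hf' hx)
      simp only [Finset.mem_insert, Finset.mem_erase]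
      exact Or.inr ⟨this.1, hxv, hxF⟩
  have h1 := Finset.card_le_card hsub
  have h2 := Finset.card_insert_le (splitPoint 𝒯 Ω F) ((F.erase v).erase v')
  rw [Finset.card_erase_of_mem (Finset.mem_erase.2 ⟨hne.2.symm, h'.vertex⟩),
    Finset.card_erase_of_mem h.vertex, h.card] at h2
  omega

theorem cell_common_face_of_vertex (h𝒯 : IsTriangulation 𝒯 Ω) {T T' F : Finset Point}
    {v : Point} (h : IsFlag 𝒯 T F v) :
    ∃ f : Finset Point, f.card = 3 ∧ f ⊆ cell 𝒯 Ω T F v ∧ f ⊆ cell 𝒯 Ω T' F v := by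
  refine ⟨insert (splitPoint 𝒯 Ω F) (F.erase v), ?_, Finset.subset_insert _ _,
    Finset.subset_insert _ _⟩
  rw [Finset.card_insert_of_notMem, Finset.card_erase_of_mem h.vertex, h.card]
  intro hm
  exact splitPoint_ne_vertex h𝒯 h.triangle h.triangle.1 (Finset.mem_of_mem_erase hm) rfl

theorem cell_common_face_of_tetrahedron (h𝒯 : IsTriangulation 𝒯 Ω) {T F : Finset Point}
    {u v w : Point} (h : IsFlag 𝒯 T F v) (hu : u ∈ F) (huv : u ≠ v) (huw : u ≠ w) :
    ∃ f : Finset Point, f.card = 3 ∧ f ⊆ cell 𝒯 Ω T F v ∧ f ⊆ cell 𝒯 Ω T F w := by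
  refine ⟨{incenter T, splitPoint 𝒯 Ω F, u}, Finset.card_eq_three.2 ⟨_, _, _,
    incenter_ne_splitPoint h𝒯 h.mem h.triangle, incenter_ne_vertex h.mem h.triangle.1 hu,
    splitPoint_ne_vertex h𝒯 h.triangle h.triangle.1 hu, rfl⟩, ?_, ?_⟩ <;>
  · intro x hx
    simp only [Finset.mem_insert, Finset.mem_singleton] at hx
    rw [mem_cell]
    obtain rfl | rfl | rfl := hx
    · exact Or.inl rfl
    · exact Or.inr (Or.inl rfl)
    · exact Or.inr (Or.inr ⟨by assumption, hu⟩)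

theorem pair_subset_iff (h𝒯 : IsTriangulation 𝒯 Ω) {F : Finset Point} {u : Point}
    (hF : F ∈ triangles 𝒯) (hu : u ∈ F) {K : Finset Point} (hK : K ∈ refinement 𝒯 Ω) :
    {splitPoint 𝒯 Ω F, u} ⊆ K ↔ ∃ T v, IsFlag 𝒯 T F v ∧ v ≠ u ∧ K = cell 𝒯 Ω T F v := by
  constructor
  · intro h
    obtain ⟨T, F', v, hfl, rfl⟩ := (mem_refinement_iff h𝒯).1 hK
    obtain ⟨rfl, huv⟩ := (pair_subset_cell_iff h𝒯 hfl hF hu).1 h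
    exact ⟨T, v, hfl, huv.symm, rfl⟩
  · rintro ⟨T, v, hfl, hvu, rfl⟩
    exact (pair_subset_cell_iff h𝒯 hfl hF hu).2 ⟨rfl, hvu.symm⟩

/-- At a singular edge of a boundary face there are two tetrahedra. -/
theorem isLabeling_two (h𝒯 : IsTriangulation 𝒯 Ω) {T F : Finset Point} {u v w : Point}
    (hns : ¬ IsShared 𝒯 F) (hv : IsFlag 𝒯 T F v) (hw : IsFlag 𝒯 T F w) (hu : u ∈ F) (hvw : v ≠ w)
    (huv : u ≠ v) (huw : u ≠ w) :
    IsLabeling (refinement 𝒯 Ω) {splitPoint 𝒯 Ω F, u} 2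
      ![⟨_, cell_mem_refinement h𝒯 hv⟩, ⟨_, cell_mem_refinement h𝒯 hw⟩] := by
  have hF := hv.triangle
  refine ⟨?_, ?_, ?_⟩
  · intro i j hij
    have hne : cell 𝒯 Ω T F v ≠ cell 𝒯 Ω T F w := fun h => hvw (cell_injective h𝒯 hv hw h).2.2
    fin_cases i <;> fin_cases j <;> simp [hne, hne.symm] at hij ⊢
  · rintro ⟨L, hL⟩
    rw [pair_subset_iff h𝒯 hF hu hL]
    simp only [Matrix.range_cons, Matrix.range_empty, Set.union_empty, Set.union_singleton,
      Set.mem_insert_iff, Set.mem_singleton_iff, Subtype.mk.injEq]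
    constructor
    · rintro (rfl | rfl)
      · exact ⟨T, w, hw, huw.symm, rfl⟩
      · exact ⟨T, v, hv, huv.symm, rfl⟩
    · rintro ⟨T', v', hfl, hv'u, rfl⟩
      have hT : T' = T := by
        by_contra hne
        exact hns ⟨T', hfl.mem, T, hv.mem, hne, hfl.subset, hv.subset⟩
      subst hT
      obtain ⟨y, -, -, -, hFe⟩ := exists_third hv.card hv.vertex hw.vertex hvw
      have hy : u = y := by
        have : u ∈ ({v, w, y} : Finset Point) := hFe ▸ hu
        simpa [huv, huw] using this
      have : v' ∈ ({v, w, y} : Finset Point) := hFe ▸ hfl.vertex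
      simp only [Finset.mem_insert, Finset.mem_singleton, ← hy, hv'u, or_false] at this
      obtain rfl | rfl := this
      exacts [Or.inr rfl, Or.inl rfl]
  · intro i j hij
    fin_cases i <;> fin_cases j <;> simp at hij ⊢
    exact cell_common_face_of_tetrahedron h𝒯 hv hu huv huw

/-- At a singular edge of a shared face there are four tetrahedra, listed here by walking around the
edge. -/
theorem isLabeling_four (h𝒯 : IsTriangulation 𝒯 Ω) {T₁ T₂ F : Finset Point} {u v w : Point}
    (hne : T₁ ≠ T₂) (hv₁ : IsFlag 𝒯 T₁ F v) (hw₁ : IsFlag 𝒯 T₁ F w) (hv₂ : IsFlag 𝒯 T₂ F v)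
    (hw₂ : IsFlag 𝒯 T₂ F w) (hu : u ∈ F) (hvw : v ≠ w) (huv : u ≠ v) (huw : u ≠ w) :
    IsLabeling (refinement 𝒯 Ω) {splitPoint 𝒯 Ω F, u} 4
      ![⟨_, cell_mem_refinement h𝒯 hv₁⟩, ⟨_, cell_mem_refinement h𝒯 hw₁⟩,
        ⟨_, cell_mem_refinement h𝒯 hw₂⟩, ⟨_, cell_mem_refinement h𝒯 hv₂⟩] := by
  have hF := hv₁.triangle
  refine ⟨?_, ?_, ?_⟩
  · intro i j hij
    have h1 : cell 𝒯 Ω T₁ F v ≠ cell 𝒯 Ω T₁ F w := fun h => hvw (cell_injective h𝒯 hv₁ hw₁ h).2.2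
    have h2 : cell 𝒯 Ω T₁ F v ≠ cell 𝒯 Ω T₂ F w := fun h => hvw (cell_injective h𝒯 hv₁ hw₂ h).2.2
    have h3 : cell 𝒯 Ω T₁ F v ≠ cell 𝒯 Ω T₂ F v := fun h => hne (cell_injective h𝒯 hv₁ hv₂ h).1
    have h4 : cell 𝒯 Ω T₁ F w ≠ cell 𝒯 Ω T₂ F w := fun h => hne (cell_injective h𝒯 hw₁ hw₂ h).1
    have h5 : cell 𝒯 Ω T₁ F w ≠ cell 𝒯 Ω T₂ F v := fun h => hne (cell_injective h𝒯 hw₁ hv₂ h).1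
    have h6 : cell 𝒯 Ω T₂ F w ≠ cell 𝒯 Ω T₂ F v :=
      fun h => hvw (cell_injective h𝒯 hw₂ hv₂ h).2.2.symm
    fin_cases i <;> fin_cases j <;>
      simp [h1, h1.symm, h2, h2.symm, h3, h3.symm, h4, h4.symm, h5, h5.symm, h6, h6.symm] at hij ⊢
  · rintro ⟨L, hL⟩
    rw [pair_subset_iff h𝒯 hF hu hL]
    simp only [Matrix.range_cons, Matrix.range_empty, Set.union_empty, Set.singleton_union,
      Set.mem_insert_iff, Set.mem_singleton_iff, Subtype.mk.injEq]
    constructor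
    · rintro (rfl | rfl | rfl | rfl)
      exacts [⟨_, _, hv₁, huv.symm, rfl⟩, ⟨_, _, hw₁, huw.symm, rfl⟩, ⟨_, _, hw₂, huw.symm, rfl⟩,
        ⟨_, _, hv₂, huv.symm, rfl⟩]
    · rintro ⟨T', v', hfl, hv'u, rfl⟩
      obtain ⟨y, -, -, -, hFe⟩ := exists_third hv₁.card hv₁.vertex hw₁.vertex hvw
      have hy : u = y := by
        have : u ∈ ({v, w, y} : Finset Point) := hFe ▸ hu
        simpa [huv, huw] using this
      have : v' ∈ ({v, w, y} : Finset Point) := hFe ▸ hfl.vertex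
      simp only [Finset.mem_insert, Finset.mem_singleton, ← hy, hv'u, or_false] at this
      rcases eq_or_eq_of_face_subset hv₁.mem hv₂.mem hfl.mem hne hfl.card hv₁.subset hv₂.subset
        hfl.subset with rfl | rfl <;> obtain rfl | rfl := this <;> simp
  · intro i j hij
    fin_cases i <;> fin_cases j <;> simp at hij ⊢
    · exact cell_common_face_of_tetrahedron h𝒯 hv₁ hu huv huw
    · exact cell_common_face_of_vertex h𝒯 hw₁
    · exact cell_common_face_of_tetrahedron h𝒯 hw₂ hu huw huv

/-- The pressure space decouples into one space for each face of the original triangulation: over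
a boundary face the values agree, and over an interior face the jump across the face is
constant. -/
theorem mem_pressureSpace_iff (h𝒯 : IsTriangulation 𝒯 Ω) {q : refinement 𝒯 Ω → ℝ} :
    q ∈ pressureSpace 𝒯 Ω ↔
      (∀ T F u v, IsFlag 𝒯 T F u → IsFlag 𝒯 T F v → ¬ IsShared 𝒯 F →
        extendZero q (cell 𝒯 Ω T F u) = extendZero q (cell 𝒯 Ω T F v)) ∧
      (∀ T₁ T₂ F u v, T₁ ≠ T₂ → IsFlag 𝒯 T₁ F u → IsFlag 𝒯 T₁ F v → IsFlag 𝒯 T₂ F u →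
        IsFlag 𝒯 T₂ F v → extendZero q (cell 𝒯 Ω T₁ F u) - extendZero q (cell 𝒯 Ω T₂ F u) =
          extendZero q (cell 𝒯 Ω T₁ F v) - extendZero q (cell 𝒯 Ω T₂ F v)) := by
  constructor
  · rintro ⟨hint, hbd⟩
    refine ⟨fun T F u v hu hv hns => ?_, fun T₁ T₂ F u v hne hu₁ hv₁ hu₂ hv₂ => ?_⟩
    · by_cases huv : u = v
      · rw [huv]
      obtain ⟨w, hw, hwu, hwv, -⟩ := exists_third hu.card hu.vertex hv.vertex huv
      have hb : {splitPoint 𝒯 Ω F, w} ∈ boundarySingularEdges (refinement 𝒯 Ω) Ω :=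
        ⟨splitPoint_vertex_mem_singularEdges h𝒯 hu.triangle hw,
          (convexHull_pair_subset_frontier_iff h𝒯 hu.triangle hw).2 hns⟩
      have := hbd _ hb _ (isLabeling_two h𝒯 hns hu hv hw huv hwu hwv)
      rw [extendZero_of_mem q (cell_mem_refinement h𝒯 hu),
        extendZero_of_mem q (cell_mem_refinement h𝒯 hv)]
      simpa [sub_eq_zero] using this
    · by_cases huv : u = v
      · rw [huv]
      obtain ⟨w, hw, hwu, hwv, -⟩ := exists_third hu₁.card hu₁.vertex hv₁.vertex huv
      have hb : {splitPoint 𝒯 Ω F, w} ∈ interiorSingularEdges (refinement 𝒯 Ω) Ω :=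
        ⟨splitPoint_vertex_mem_singularEdges h𝒯 hu₁.triangle hw,
          fun h => (convexHull_pair_subset_frontier_iff h𝒯 hu₁.triangle hw).1 h
            ⟨T₁, hu₁.mem, T₂, hu₂.mem, hne, hu₁.subset, hu₂.subset⟩⟩
      have := hint _ hb _ (isLabeling_four h𝒯 hne hu₁ hv₁ hu₂ hv₂ hw huv hwu hwv)
      rw [extendZero_of_mem q (cell_mem_refinement h𝒯 hu₁),
        extendZero_of_mem q (cell_mem_refinement h𝒯 hv₁),
        extendZero_of_mem q (cell_mem_refinement h𝒯 hu₂),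
        extendZero_of_mem q (cell_mem_refinement h𝒯 hv₂)]
      have h' : q ⟨_, cell_mem_refinement h𝒯 hu₁⟩ - q ⟨_, cell_mem_refinement h𝒯 hv₁⟩ +
        q ⟨_, cell_mem_refinement h𝒯 hv₂⟩ - q ⟨_, cell_mem_refinement h𝒯 hu₂⟩ = 0 := this
      linarith
  · rintro ⟨hbd, hint⟩
    refine ⟨fun e he K hK => ?_, fun e he K hK => ?_⟩
    · obtain ⟨F, hF, u, hu, rfl⟩ := (mem_singularEdges_iff h𝒯).1 he.1
      have hS : IsShared 𝒯 F := by
        by_contra hS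
        exact he.2 ((convexHull_pair_subset_frontier_iff h𝒯 hF hu).2 hS)
      obtain ⟨T₁, h₁, T₂, h₂, hne, hF1, hF2⟩ := hS
      obtain ⟨v, hv, hvu⟩ := Finset.exists_mem_ne (by rw [hF.2]; omega : 1 < F.card) u
      obtain ⟨w, hw, hwu, hwv, hFe⟩ := exists_third hF.2 hu hv hvu.symm
      have key (i : Fin 4) : ∃ T x, IsFlag 𝒯 T F x ∧ (T = T₁ ∨ T = T₂) ∧ (x = v ∨ x = w) ∧
          (K i : Finset Point) = cell 𝒯 Ω T F x := by
        obtain ⟨T, x, hfl, hxu, hKi⟩ := (pair_subset_iff h𝒯 hF hu (K i).2).1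
          ((hK.mem_range_iff (K i)).1 ⟨i, rfl⟩)
        refine ⟨T, x, hfl, eq_or_eq_of_face_subset h₁ h₂ hfl.mem hne hF.2 hF1 hF2 hfl.subset, ?_,
          hKi⟩
        have : x ∈ ({u, v, w} : Finset Point) := hFe ▸ hfl.vertex
        simpa [hxu] using this
      choose T x hfl hT hx hKx using key
      -- Consecutive tetrahedra of the list differ either in `T` or in `x`, not in both.
      have hcons (i j : Fin 4) (hij : (j : ℕ) = (i : ℕ) + 1) : T i = T j ∨ x i = x j := by
        obtain ⟨f, hf3, hfi, hfj⟩ := hK.common_face i j hij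
        exact eq_or_eq_of_common_face h𝒯 (hfl i) (hfl j) hf3 (hKx i ▸ hfi) (hKx j ▸ hfj)
      have hinj (i j : Fin 4) (hij : i ≠ j) : ¬ (T i = T j ∧ x i = x j) := by
        rintro ⟨h1, h2⟩
        refine hij (hK.injective (Subtype.ext ?_))
        rw [hKx i, hKx j, h1, h2]
      have hq (i : Fin 4) : q (K i) = extendZero q (cell 𝒯 Ω (T i) F (x i)) := by
        rw [← hKx i, extendZero_coe]
      have hrel := hint T₁ T₂ F v w hne ⟨h₁, hF1, hF.2, hv⟩ ⟨h₁, hF1, hF.2, hw⟩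
        ⟨h₂, hF2, hF.2, hv⟩ ⟨h₂, hF2, hF.2, hw⟩
      have c01 := hcons 0 1 rfl
      have c12 := hcons 1 2 rfl
      have c23 := hcons 2 3 rfl
      have i01 := hinj 0 1 (by decide)
      have i02 := hinj 0 2 (by decide)
      have i03 := hinj 0 3 (by decide)
      have i12 := hinj 1 2 (by decide)
      have i13 := hinj 1 3 (by decide)
      have i23 := hinj 2 3 (by decide)
      rw [hq, hq, hq, hq]
      clear hcons hinj hq hKx hfl
      -- The list runs once around the cycle of the four tetrahedra, so the alternating sum is the
      -- relation `hrel` up to sign.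
      rcases hT 0 with t0 | t0 <;> rcases hx 0 with x0 | x0 <;>
      rcases hT 1 with t1 | t1 <;> rcases hx 1 with x1 | x1 <;>
      simp only [t0, t1, x0, x1, hne, hne.symm, hwv, hwv.symm, or_self, and_self, not_true_eq_false]
        at c01 i01 <;>
      rcases hT 2 with t2 | t2 <;> rcases hx 2 with x2 | x2 <;>
      simp only [t0, t1, t2, x0, x1, x2, hne, hne.symm, hwv, hwv.symm, or_self, and_self,
        not_true_eq_false] at c12 i12 i02 <;>
      rcases hT 3 with t3 | t3 <;> rcases hx 3 with x3 | x3 <;>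
      simp only [t0, t1, t2, t3, x0, x1, x2, x3, hne, hne.symm, hwv, hwv.symm, or_self, and_self,
        not_true_eq_false] at c23 i23 i13 i03 <;>
      · rw [t0, t1, t2, t3, x0, x1, x2, x3]
        linarith
    · obtain ⟨F, hF, u, hu, rfl⟩ := (mem_singularEdges_iff h𝒯).1 he.1
      have hS := (convexHull_pair_subset_frontier_iff h𝒯 hF hu).1 he.2
      have key (i : Fin 2) : ∃ T x, IsFlag 𝒯 T F x ∧ (K i : Finset Point) = cell 𝒯 Ω T F x := by
        obtain ⟨T, x, hfl, -, hKi⟩ := (pair_subset_iff h𝒯 hF hu (K i).2).1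
          ((hK.mem_range_iff (K i)).1 ⟨i, rfl⟩)
        exact ⟨T, x, hfl, hKi⟩
      obtain ⟨T, x, hfl, hK0⟩ := key 0
      obtain ⟨T', x', hfl', hK1⟩ := key 1
      have hT : T = T' := by
        by_contra hne
        exact hS ⟨T, hfl.mem, T', hfl'.mem, hne, hfl.subset, hfl'.subset⟩
      subst hT
      rw [← extendZero_coe q (K 0), ← extendZero_coe q (K 1), hK0, hK1, hbd T F x x' hfl hfl' hS,
        sub_self]

/-! ### The dimension count -/

/-- The faces of `𝒯` that belong to two tetrahedra. -/
abbrev SharedTriangle (𝒯 : Geometry.SimplicialComplex ℝ Point) : Type :=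
  {F : Finset Point // F ∈ triangles 𝒯 ∧ IsShared 𝒯 F}

/-- The free parameters of a function in the pressure space: one number for each triangular face,
and in addition one for each vertex of each shared face. -/
abbrev Parameters (𝒯 : Geometry.SimplicialComplex ℝ Point) : Type :=
  (triangles 𝒯 → ℝ) × ((Σ F : SharedTriangle 𝒯, F.1) → ℝ)

/-- The value on `cell 𝒯 Ω T F v` of the function with the given parameters. Over a boundary face
it is the number of the face. Over a shared face it is the number of the vertex `v` on the side of
the reference tetrahedron `t F`, and on the other side the number of the face is added. -/
noncomputable def cellValue (t : Finset Point → Finset Point) (x : Parameters 𝒯)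
    {T F : Finset Point} {v : Point} (h : IsFlag 𝒯 T F v) : ℝ :=
  if hS : IsShared 𝒯 F then
    x.2 ⟨⟨F, h.triangle, hS⟩, ⟨v, h.vertex⟩⟩ + if T = t F then 0 else x.1 ⟨F, h.triangle⟩
  else x.1 ⟨F, h.triangle⟩

theorem exists_isFlag (h𝒯 : IsTriangulation 𝒯 Ω) (K : refinement 𝒯 Ω) :
    ∃ x : Finset Point × Finset Point × Point, IsFlag 𝒯 x.1 x.2.1 x.2.2 ∧
      (K : Finset Point) = cell 𝒯 Ω x.1 x.2.1 x.2.2 := by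
  obtain ⟨T, F, v, h⟩ := (mem_refinement_iff h𝒯).1 K.2
  exact ⟨(T, F, v), h⟩

/-- The piecewise constant function with given parameters. -/
noncomputable def ofParameters (h𝒯 : IsTriangulation 𝒯 Ω) (t : Finset Point → Finset Point) :
    Parameters 𝒯 →ₗ[ℝ] (refinement 𝒯 Ω → ℝ) where
  toFun x K := cellValue t x (exists_isFlag h𝒯 K).choose_spec.1
  map_add' x y := by
    ext K
    simp only [cellValue, Prod.fst_add, Prod.snd_add, Pi.add_apply]
    split_ifs <;> ring
  map_smul' c x := by
    ext K
    simp only [cellValue, Prod.smul_fst, Prod.smul_snd, Pi.smul_apply, smul_eq_mul,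
      RingHom.id_apply]
    split_ifs <;> ring

theorem ofParameters_cell (h𝒯 : IsTriangulation 𝒯 Ω) (t : Finset Point → Finset Point)
    (x : Parameters 𝒯) {T F : Finset Point} {v : Point} (h : IsFlag 𝒯 T F v) :
    extendZero (ofParameters h𝒯 t x) (cell 𝒯 Ω T F v) = cellValue t x h := by
  rw [extendZero_of_mem _ (cell_mem_refinement h𝒯 h)]
  have hspec := (exists_isFlag h𝒯 ⟨_, cell_mem_refinement h𝒯 h⟩).choose_spec
  change cellValue t x hspec.1 = _
  generalize (exists_isFlag h𝒯 ⟨_, cell_mem_refinement h𝒯 h⟩).choose = y at hspec ⊢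
  obtain ⟨T', F', v'⟩ := y
  obtain ⟨h', he⟩ := hspec
  obtain ⟨rfl, rfl, rfl⟩ := cell_injective h𝒯 h h' he
  rfl

theorem IsShared.exists_ne {F : Finset Point} (hS : IsShared 𝒯 F) (T : Finset Point) :
    ∃ T' ∈ tetrahedra 𝒯, F ⊆ T' ∧ T' ≠ T := by
  obtain ⟨T₁, h₁, T₂, h₂, hne, hF1, hF2⟩ := hS
  by_cases h : T₁ = T
  · exact ⟨T₂, h₂, hF2, fun h' => hne (h.trans h'.symm)⟩
  · exact ⟨T₁, h₁, hF1, h⟩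

theorem ofParameters_injective (h𝒯 : IsTriangulation 𝒯 Ω) {t : Finset Point → Finset Point}
    (ht : ∀ F ∈ triangles 𝒯, t F ∈ tetrahedra 𝒯 ∧ F ⊆ t F) :
    Function.Injective (ofParameters h𝒯 t) := by
  rw [injective_iff_map_eq_zero]
  intro x hx
  have hval {T F : Finset Point} {v : Point} (h : IsFlag 𝒯 T F v) : cellValue t x h = 0 := by
    rw [← ofParameters_cell h𝒯 t x h, hx, extendZero_of_mem _ (cell_mem_refinement h𝒯 h)]
    rfl
  have h2 (F : Finset Point) (hF : F ∈ triangles 𝒯) (hS : IsShared 𝒯 F) (v : Point) (hv : v ∈ F) :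
      x.2 ⟨⟨F, hF, hS⟩, ⟨v, hv⟩⟩ = 0 := by
    have := hval (⟨(ht F hF).1, (ht F hF).2, hF.2, hv⟩ : IsFlag 𝒯 (t F) F v)
    simpa [cellValue, hS] using this
  refine Prod.ext (funext ?_) (funext ?_)
  · rintro ⟨F, hF⟩
    obtain ⟨v, hv⟩ := 𝒯.nonempty_of_mem_faces hF.1
    by_cases hS : IsShared 𝒯 F
    · obtain ⟨T', hT', hFT', hne⟩ := hS.exists_ne (t F)
      have := hval (⟨hT', hFT', hF.2, hv⟩ : IsFlag 𝒯 T' F v)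
      simpa [cellValue, hS, hne, h2 F hF hS v hv] using this
    · have := hval (⟨(ht F hF).1, (ht F hF).2, hF.2, hv⟩ : IsFlag 𝒯 (t F) F v)
      simpa [cellValue, hS] using this
  · rintro ⟨⟨F, hF, hS⟩, ⟨v, hv⟩⟩
    exact h2 F hF hS v hv

theorem range_ofParameters (h𝒯 : IsTriangulation 𝒯 Ω) {t : Finset Point → Finset Point}
    (ht : ∀ F ∈ triangles 𝒯, t F ∈ tetrahedra 𝒯 ∧ F ⊆ t F) :
    LinearMap.range (ofParameters h𝒯 t) = pressureSpace 𝒯 Ω := by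
  apply le_antisymm
  · rintro _ ⟨x, rfl⟩
    rw [mem_pressureSpace_iff h𝒯]
    refine ⟨fun T F u v hu hv hns => ?_, fun T₁ T₂ F u v hne hu₁ hv₁ hu₂ hv₂ => ?_⟩
    · rw [ofParameters_cell h𝒯 t x hu, ofParameters_cell h𝒯 t x hv]
      simp [cellValue, hns]
    · have hS : IsShared 𝒯 F := ⟨T₁, hu₁.mem, T₂, hu₂.mem, hne, hu₁.subset, hu₂.subset⟩
      rw [ofParameters_cell h𝒯 t x hu₁, ofParameters_cell h𝒯 t x hv₁,
        ofParameters_cell h𝒯 t x hu₂, ofParameters_cell h𝒯 t x hv₂]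
      simp only [cellValue, hS, dif_pos]
      ring
  · intro q hq
    obtain ⟨hbd, hint⟩ := (mem_pressureSpace_iff h𝒯).1 hq
    have hvert (F : triangles 𝒯) : ∃ v, v ∈ F.1 := 𝒯.nonempty_of_mem_faces F.2.1
    choose v₀ hv₀ using hvert
    have hopp (F : Finset Point) : ∃ T', IsShared 𝒯 F → T' ∈ tetrahedra 𝒯 ∧ F ⊆ T' ∧ T' ≠ t F := by
      by_cases hS : IsShared 𝒯 F
      · obtain ⟨T', h⟩ := hS.exists_ne (t F)
        exact ⟨T', fun _ => h⟩
      · exact ⟨∅, fun h => absurd h hS⟩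
    choose t' ht' using hopp
    let x : Parameters 𝒯 :=
      (fun F => if IsShared 𝒯 F.1 then extendZero q (cell 𝒯 Ω (t' F) F (v₀ F)) -
          extendZero q (cell 𝒯 Ω (t F) F (v₀ F)) else extendZero q (cell 𝒯 Ω (t F) F (v₀ F)),
        fun y => extendZero q (cell 𝒯 Ω (t y.1.1) y.1.1 y.2.1))
    refine ⟨x, funext fun K => ?_⟩
    obtain ⟨T, F, v, h, hK⟩ := (mem_refinement_iff h𝒯).1 K.2
    rw [← extendZero_coe (ofParameters h𝒯 t x) K, ← extendZero_coe q K, hK,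
      ofParameters_cell h𝒯 t x h]
    have hF := h.triangle
    have hv := hv₀ ⟨F, hF⟩
    by_cases hS : IsShared 𝒯 F
    · obtain ⟨h₁, hF₁, hne⟩ := ht' F hS
      by_cases hT : T = t F
      · subst hT
        simp [cellValue, hS, x]
      · have hT' : T = t' F := by
          rcases eq_or_eq_of_face_subset (ht F hF).1 h₁ h.mem hne.symm hF.2 (ht F hF).2 hF₁
            h.subset with h | h
          exacts [absurd h hT, h]
        subst hT'
        have := hint (t' F) (t F) F v (v₀ ⟨F, hF⟩) hne h ⟨h.mem, h.subset, h.card, hv⟩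
          ⟨(ht F hF).1, (ht F hF).2, h.card, h.vertex⟩ ⟨(ht F hF).1, (ht F hF).2, h.card, hv⟩
        simp only [cellValue, hS, dif_pos, if_pos, if_neg hT, x]
        linarith
    · have hT : T = t F := by
        by_contra hne
        exact hS ⟨T, h.mem, t F, (ht F hF).1, hne, h.subset, (ht F hF).2⟩
      subst hT
      simp only [cellValue, hS, dif_neg, not_false_eq_true, if_false, x]
      exact hbd _ F _ _ ⟨h.mem, h.subset, h.card, hv⟩ h hS

theorem finrank_parameters (hfin : (triangles 𝒯).Finite) :
    Module.Finite ℝ (Parameters 𝒯) ∧ Module.finrank ℝ (Parameters 𝒯) =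
      4 * {F | F ∈ triangles 𝒯 ∧ IsShared 𝒯 F}.ncard +
        {F | F ∈ triangles 𝒯 ∧ ¬ IsShared 𝒯 F}.ncard := by
  have hfin' : {F | F ∈ triangles 𝒯 ∧ IsShared 𝒯 F}.Finite := hfin.subset fun F h => h.1
  have hfin'' : {F | F ∈ triangles 𝒯 ∧ ¬ IsShared 𝒯 F}.Finite := hfin.subset fun F h => h.1
  have : Fintype (triangles 𝒯) := hfin.fintype
  have : Fintype (SharedTriangle 𝒯) := hfin'.fintype
  refine ⟨inferInstance, ?_⟩
  have h1 : Fintype.card (triangles 𝒯) = {F | F ∈ triangles 𝒯 ∧ IsShared 𝒯 F}.ncard +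
      {F | F ∈ triangles 𝒯 ∧ ¬ IsShared 𝒯 F}.ncard := by
    rw [← Set.ncard_union_eq (Set.disjoint_left.2 fun F h h' => h'.2 h.2) hfin' hfin'',
      ← Nat.card_eq_fintype_card, Nat.card_coe_set_eq]
    congr 1
    ext F
    simp only [Set.mem_union, Set.mem_ofPred_eq]
    tauto
  have h2 : Fintype.card (SharedTriangle 𝒯) = {F | F ∈ triangles 𝒯 ∧ IsShared 𝒯 F}.ncard := by
    rw [← Nat.card_eq_fintype_card]
    exact Nat.card_coe_set_eq _
  have h3 (F : SharedTriangle 𝒯) : Fintype.card F.1 = 3 := by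
    rw [Fintype.card_coe, F.2.1.2]
  rw [Module.finrank_prod, Module.finrank_fintype_fun_eq_card,
    Module.finrank_fintype_fun_eq_card, Fintype.card_sigma, Finset.sum_congr rfl fun F _ => h3 F,
    Finset.sum_const, Finset.card_univ, h1, h2, smul_eq_mul]
  ring

end WorseyFarin

theorem mainTheorem4 (𝒯 : Geometry.SimplicialComplex ℝ WorseyFarin.Point)
    (Ω : Set WorseyFarin.Point) (h𝒯 : WorseyFarin.IsTriangulation 𝒯 Ω) :
    (WorseyFarin.interiorSplitPoints 𝒯 Ω).Finite ∧
    (WorseyFarin.boundarySplitPoints 𝒯 Ω).Finite ∧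
    Module.Finite ℝ (WorseyFarin.pressureSpace 𝒯 Ω) ∧
    Module.finrank ℝ (WorseyFarin.pressureSpace 𝒯 Ω) =
      4 * (WorseyFarin.interiorSplitPoints 𝒯 Ω).ncard +
        (WorseyFarin.boundarySplitPoints 𝒯 Ω).ncard := by
  have hfin : (WorseyFarin.triangles 𝒯).Finite := h𝒯.finite_faces.subset fun F h => h.1
  obtain ⟨hM, hrank⟩ := WorseyFarin.finrank_parameters hfin
  have ht (F : Finset WorseyFarin.Point) : ∃ T, F ∈ WorseyFarin.triangles 𝒯 →
      T ∈ WorseyFarin.tetrahedra 𝒯 ∧ F ⊆ T := by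
    by_cases hF : F ∈ WorseyFarin.triangles 𝒯
    · obtain ⟨T, hT⟩ := h𝒯.pure F hF.1
      exact ⟨T, fun _ => hT⟩
    · exact ⟨∅, fun h => absurd h hF⟩
  choose t ht using ht
  let e : WorseyFarin.Parameters 𝒯 ≃ₗ[ℝ] WorseyFarin.pressureSpace 𝒯 Ω :=
    (LinearEquiv.ofInjective _ (WorseyFarin.ofParameters_injective h𝒯 ht)).trans
      (LinearEquiv.ofEq _ _ (WorseyFarin.range_ofParameters h𝒯 ht))
  rw [WorseyFarin.interiorSplitPoints_eq h𝒯, WorseyFarin.boundarySplitPoints_eq h𝒯]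
  refine ⟨(hfin.subset fun F h => h.1).image _, (hfin.subset fun F h => h.1).image _,
    Module.Finite.equiv e, ?_⟩
  rw [← e.finrank_eq, hrank,
    ((WorseyFarin.splitPoint_injOn h𝒯).mono fun F h => h.1).ncard_image,
    ((WorseyFarin.splitPoint_injOn h𝒯).mono fun F h => h.1).ncard_image]
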